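/- For real $\lambda>-1/2$ let $\hat p^{(\lambda)}_n$ ($n=0,1,2,\dots$) be the orthonormal ultraspherical polynomials, i.e. $\hat p^{(\lambda)}_n$ is a real polynomial of degree $n$ with positive leading coefficient and $\int_{-1}^1\hat p^{(\lambda)}_m(x)\hat p^{(\lambda)}_n(x)(1-x^2)^{\lambda-1/2}\,dx=\delta_{m,n}$. For integers $i,j\ge 0$ put $$f^{(\lambda)}_{i,j}=\int_0^1\hat p^{(\lambda)}_i(x)\,\hat p^{(\lambda)}_j(2x-1)\,(x(1-x))^{\lambda-1/2}\,dx .$$ **Theorem.** Let $\lambda>-1/2$ and let $k_1>k_2>0$ be fixed real numbers with $\sqrt2\,k_2/k_1>1$. Put $$\epsilon=\frac{k_2}{k_1},\qquad \hat b(\epsilon)=\sqrt{2\epsilon^2-1},\qquad c(\epsilon,\lambda)=\epsilon^{\lambda}\,\frac{1}{\sqrt{\pi(1-\epsilon^2)(2\epsilon^2-1)^{1/2}}}.$$ Then, as $t\to\infty$ through those real $t$ for which $k_1t$ and $k_2t$ are both integers, $$f^{(\lambda)}_{k_1t,\,k_2t}=\frac{c(\epsilon,\lambda)}{2^{k_1t+2\lambda}\,(k_1t)^{1/2}}\left(\frac{1+\hat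 b(\epsilon)}{\epsilon-\hat b(\epsilon)}\right)^{(k_1-k_2)t}\left(\frac{1+2\epsilon-\hat b(\epsilon)}{1+\epsilon}\right)^{(k_1+k_2)t+2\lambda}\bigl(1+O(1/t)\bigr),$$ where the constant implied by $O(1/t)$ may depend on $\lambda$, $k_1$ and $k_2$. -/

import Mathlib

noncomputable section

/-- The pairing `⟨p, q⟩ = ∫_{-1}^{1} p(x) q(x) (1 - x²)^(lam - 1/2) dx` of real polynomials. -/
def ultraInner (lam : ℝ) (p q : Polynomial ℝ) : ℝ :=
  ∫ x in (-1 : ℝ)..1, p.eval x * q.eval x * (1 - x ^ 2) ^ (lam - 1 / 2)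

/-- The monic orthogonal polynomial of degree `n` for the weight `(1 - x²)^(lam - 1/2)` on
`[-1, 1]`, by Gram-Schmidt orthogonalization of `1, X, X², …`. -/
def ultraMonic (lam : ℝ) (n : ℕ) : Polynomial ℝ :=
  Polynomial.X ^ n - ∑ m : Fin n,
    Polynomial.C (ultraInner lam (Polynomial.X ^ n) (ultraMonic lam m) /
      ultraInner lam (ultraMonic lam m) (ultraMonic lam m)) * ultraMonic lam m
termination_by n
decreasing_by all_goals exact m.isLt

/-- The orthonormal ultraspherical polynomial of degree `n` with positive leading coefficient,
for the weight `(1 - x²)^(lam - 1/2)` on `[-1, 1]`. -/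
def ultraOrthonormal (lam : ℝ) (n : ℕ) : Polynomial ℝ :=
  Polynomial.C (Real.sqrt (ultraInner lam (ultraMonic lam n) (ultraMonic lam n)))⁻¹ *
    ultraMonic lam n

/-- The coefficient `∫_0^1 p̂_i(x) p̂_j(2x - 1) (x(1 - x))^(lam - 1/2) dx`, where `p̂_n` are the
orthonormal ultraspherical polynomials. -/
def ultraCoeff (lam : ℝ) (i j : ℕ) : ℝ :=
  ∫ x in (0 : ℝ)..1, (ultraOrthonormal lam i).eval x * (ultraOrthonormal lam j).eval (2 * x - 1) *
    (x * (1 - x)) ^ (lam - 1 / 2)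

/-- `b̂(ε) = √(2ε² - 1)`. -/
def bHat (ε : ℝ) : ℝ := Real.sqrt (2 * ε ^ 2 - 1)

/-- `c(ε, lam) = ε^lam / √(π (1 - ε²) (2ε² - 1)^(1/2))`. -/
def cConst (ε lam : ℝ) : ℝ :=
  ε ^ lam * (1 / Real.sqrt (Real.pi * (1 - ε ^ 2) * (2 * ε ^ 2 - 1) ^ (1 / 2 : ℝ)))

end

/-! The coefficient is first computed exactly, then estimated at a saddle point.

Exact part. Ultraspherical polynomials are terminating hypergeometric sums in `(1 - x) / 2` or, by
symmetry, in `(1 + x) / 2`. Expand the polynomial of degree `i` in powers of `1 - x`, and the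
polynomial of degree `j`, taken at `2x - 1`, in powers of `x`. Pairing the latter with `(1 - x) ^ k`
gives Beta integrals whose sum Chu-Vandermonde evaluates; the result vanishes for `k < j`
(`unitIntegral_shiftedUltra_mul_pow`). This one evaluation yields orthogonality, the norms, and a
single alternating sum for the coefficient. With `p = i - j - 1`, that sum is, up to explicit
factors, the coefficient of `z ^ p` in `(1 + z) ^ (i + j + 2 lam - 1) * (1 - z) ^ (p + 1)`
(`ultraCoeff_eq`).

Asymptotic part. Cauchy's formula writes this coefficient as an integral over `|z| = r < 1`. When `j
= ε i`, the integrand is `exp (i Φ)` times a fixed amplitude, where `Φ` is `(1 + ε) log (1 + z) + (1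
- ε) log (1 - z) - (1 - ε) log z` up to a constant. Its saddle points solve `(1 + ε) z² - 2 ε z + (1
- ε) = 0`, that is `z = (ε ± b) / (1 + ε)` with `b² = 2 ε² - 1`. The hypothesis `√2 ε > 1` makes
them real and distinct. The smaller one lies in `(0, 1)`, and on its circle the real part of `Φ` has
a nondegenerate maximum there (`re_saddlePhase_le`, `saddlePoint_curvature`). Laplace's method
(`exists_norm_integral_exp_mul_sub_le`) gives the Gaussian value with relative error `O(1 / i)`,
because the first corrections are odd in the angle. The normalizing factors are Gamma ratios, known
to the same precision by log-convexity (`isOneAddBigOInv_Gamma`). -/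

section Moments

open Polynomial Finset

/-! ### Rising factorials and the Chu-Vandermonde sum -/

/-- The rising factorial `a (a + 1) ⋯ (a + n - 1)`. -/
def risingFactorial (a : ℝ) (n : ℕ) : ℝ := ∏ k ∈ range n, (a + k)

lemma risingFactorial_zero (a : ℝ) : risingFactorial a 0 = 1 := by simp [risingFactorial]

lemma risingFactorial_succ (a : ℝ) (n : ℕ) :
    risingFactorial a (n + 1) = risingFactorial a n * (a + n) := by
  simp [risingFactorial, prod_range_succ]

lemma risingFactorial_succ' (a : ℝ) (n : ℕ) :
    risingFactorial a (n + 1) = a * risingFactorial (a + 1) n := by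
  simp only [risingFactorial, prod_range_succ']
  rw [mul_comm]
  congr 1
  · simp
  · refine prod_congr rfl fun k _ => ?_
    push_cast; ring

lemma risingFactorial_pos {a : ℝ} (ha : 0 < a) (n : ℕ) : 0 < risingFactorial a n :=
  prod_pos fun k _ => by positivity

lemma Gamma_add_natCast {a : ℝ} (ha : 0 < a) (n : ℕ) :
    Real.Gamma (a + n) = risingFactorial a n * Real.Gamma a := by
  induction n with
  | zero => simp [risingFactorial_zero]
  | succ n ih =>
    rw [Nat.cast_succ, ← add_assoc, Real.Gamma_add_one (by positivity), ih, risingFactorial_succ]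
    ring

/-- Orthogonality originates here: the product contains the factor zero as soon as `m < n`. -/
lemma risingFactorial_sub_natCast (m n : ℕ) :
    risingFactorial ((m : ℝ) + 1 - n) n = m.descFactorial n := by
  induction n with
  | zero => simp [risingFactorial_zero]
  | succ n ih =>
    rw [risingFactorial_succ', show (m : ℝ) + 1 - (n + 1 : ℕ) + 1 = m + 1 - n by push_cast; ring, ih,
      Nat.descFactorial_succ]
    push_cast
    rcases le_or_gt n m with h | h
    · rw [Nat.cast_sub h]; ring
    · simp [Nat.descFactorial_of_lt h]

/-- Pascal's rule under the sum; it drives the induction for Chu-Vandermonde. -/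
lemma sum_range_choose_succ {M : Type*} [AddCommGroup M] (n : ℕ) (f : ℕ → M) :
    ∑ k ∈ range (n + 2), ((n + 1).choose k : ℤ) • f k =
      ∑ k ∈ range (n + 1), (n.choose k : ℤ) • f k +
        ∑ k ∈ range (n + 1), (n.choose k : ℤ) • f (k + 1) := by
  rw [sum_range_succ' _ (n + 1)]
  simp only [Nat.choose_succ_succ, Nat.cast_add, add_smul, sum_add_distrib, Nat.choose_zero_right]
  rw [sum_range_succ (fun k => ((n.choose (k + 1) : ℕ) : ℤ) • f (k + 1)) n,
    sum_range_succ' (fun k => (n.choose k : ℤ) • f k) n]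
  simp
  abel

/-- The **Chu-Vandermonde** summation formula. -/
lemma sum_choose_mul_risingFactorial_div (n : ℕ) (b c : ℝ) (hc : 0 < c) :
    ∑ k ∈ range (n + 1),
        (-1) ^ k * (n.choose k : ℝ) * (risingFactorial b k / risingFactorial c k) =
      risingFactorial (c - b) n / risingFactorial c n := by
  induction n generalizing b c with
  | zero => simp [risingFactorial_zero]
  | succ n ih =>
    have key := sum_range_choose_succ n
      (fun k => (-1 : ℝ) ^ k * (risingFactorial b k / risingFactorial c k))
    -- The shifted half of Pascal's rule is the same sum at `(b + 1, c + 1)`, with the same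
    -- difference `c - b`. The induction hypothesis therefore applies to both halves.
    have e : ∀ k, risingFactorial b (k + 1) / risingFactorial c (k + 1) =
        b / c * (risingFactorial (b + 1) k / risingFactorial (c + 1) k) := fun k => by
      rw [risingFactorial_succ', risingFactorial_succ', mul_div_mul_comm]
    have e2 : ∑ k ∈ range (n + 1),
          (n.choose k : ℤ) •
            ((-1 : ℝ) ^ (k + 1) * (risingFactorial b (k + 1) / risingFactorial c (k + 1))) =
        -(b / c) * ∑ k ∈ range (n + 1), (-1) ^ k * (n.choose k : ℝ) *
            (risingFactorial (b + 1) k / risingFactorial (c + 1) k) := by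
      rw [mul_sum]
      refine sum_congr rfl fun k _ => ?_
      rw [e, pow_succ]; simp; ring
    have e1 : ∑ k ∈ range (n + 1),
          (n.choose k : ℤ) • ((-1 : ℝ) ^ k * (risingFactorial b k / risingFactorial c k)) =
        ∑ k ∈ range (n + 1),
          (-1) ^ k * (n.choose k : ℝ) * (risingFactorial b k / risingFactorial c k) := by
      refine sum_congr rfl fun k _ => ?_
      simp; ring
    rw [e1, e2, ih b c hc, ih (b + 1) (c + 1) (by positivity)] at key
    have hL : ∑ k ∈ range (n + 1 + 1),
        (-1) ^ k * ((n + 1).choose k : ℝ) * (risingFactorial b k / risingFactorial c k) =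
        ∑ k ∈ range (n + 2), ((n + 1).choose k : ℤ) •
          ((-1 : ℝ) ^ k * (risingFactorial b k / risingFactorial c k)) := by
      refine sum_congr rfl fun k _ => ?_
      simp; ring
    rw [hL, key, show c + 1 - (b + 1) = c - b by ring, risingFactorial_succ,
      risingFactorial_succ c n]
    have h1 := risingFactorial_pos hc n
    have h2 := risingFactorial_pos (show 0 < c + 1 by positivity) n
    have h3 : c * risingFactorial (c + 1) n = risingFactorial c n * (c + n) := by
      rw [← risingFactorial_succ', risingFactorial_succ]
    have h4 : risingFactorial (c + 1) n = risingFactorial c n * (c + n) / c := by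
      rw [← h3]; field_simp
    rw [h4]
    field_simp
    ring

/-! ### The weight `(x (1 - x)) ^ (lam - 1/2)` on the unit interval -/

lemma betaIntegrand_eqOn (a b : ℝ) {x : ℝ} (hx : x ∈ Set.Ioc (0 : ℝ) 1) :
    (x : ℂ) ^ ((a : ℂ) - 1) * (1 - (x : ℂ)) ^ ((b : ℂ) - 1) =
      ((x ^ (a - 1) * (1 - x) ^ (b - 1) : ℝ) : ℂ) := by
  push_cast
  rw [Complex.ofReal_cpow hx.1.le, Complex.ofReal_cpow (by linarith [hx.2])]
  push_cast
  rfl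

lemma intervalIntegrable_rpow_mul_one_sub_rpow {a b : ℝ} (ha : 0 < a) (hb : 0 < b) :
    IntervalIntegrable (fun x : ℝ => x ^ (a - 1) * (1 - x) ^ (b - 1)) MeasureTheory.volume 0 1 := by
  have h := Complex.betaIntegral_convergent (u := a) (v := b) (by simpa) (by simpa)
  rw [intervalIntegrable_iff_integrableOn_Ioc_of_le (by norm_num)] at h ⊢
  have h2 := (MeasureTheory.integrableOn_congr_fun
    (fun x hx => betaIntegrand_eqOn a b hx) measurableSet_Ioc).1 h
  simpa [MeasureTheory.IntegrableOn] using h2.re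

lemma integral_rpow_mul_one_sub_rpow {a b : ℝ} (ha : 0 < a) (hb : 0 < b) :
    ∫ x in (0 : ℝ)..1, x ^ (a - 1) * (1 - x) ^ (b - 1) =
      Real.Gamma a * Real.Gamma b / Real.Gamma (a + b) := by
  have h := Complex.betaIntegral_eq_Gamma_mul_div (a : ℂ) (b : ℂ) (by simpa) (by simpa)
  rw [Complex.betaIntegral, intervalIntegral.integral_of_le (by norm_num),
    MeasureTheory.setIntegral_congr_fun measurableSet_Ioc
      (fun x hx => betaIntegrand_eqOn a b hx), integral_complex_ofReal] at h
  rw [intervalIntegral.integral_of_le (by norm_num)]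
  rw [← Complex.ofReal_add, Complex.Gamma_ofReal, Complex.Gamma_ofReal, Complex.Gamma_ofReal] at h
  exact_mod_cast h

/-- The integral of a polynomial against the weight `(x (1 - x)) ^ (lam - 1/2)` on `[0, 1]`. -/
noncomputable def unitIntegral (lam : ℝ) (p : ℝ[X]) : ℝ :=
  ∫ x in (0 : ℝ)..1, p.eval x * (x * (1 - x)) ^ (lam - 1 / 2)

section UnitIntegral

variable {lam : ℝ}

lemma intervalIntegrable_unitWeight (hlam : -1 / 2 < lam) (p : ℝ[X]) :
    IntervalIntegrable (fun x => p.eval x * (x * (1 - x)) ^ (lam - 1 / 2))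
      MeasureTheory.volume 0 1 := by
  have h : IntervalIntegrable (fun x : ℝ => (x * (1 - x)) ^ (lam - 1 / 2))
      MeasureTheory.volume 0 1 := by
    have h := intervalIntegrable_rpow_mul_one_sub_rpow (a := lam + 1 / 2) (b := lam + 1 / 2)
      (by linarith) (by linarith)
    rw [intervalIntegrable_iff_integrableOn_Ioc_of_le (by norm_num)] at h ⊢
    refine (MeasureTheory.integrableOn_congr_fun (fun x hx => ?_) measurableSet_Ioc).1 h
    rw [Real.mul_rpow hx.1.le (by linarith [hx.2])]
    ring_nf
  exact h.continuousOn_mul p.continuous.continuousOn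

lemma unitIntegral_add (hlam : -1 / 2 < lam) (p q : ℝ[X]) :
    unitIntegral lam (p + q) = unitIntegral lam p + unitIntegral lam q := by
  simp only [unitIntegral, eval_add, add_mul]
  exact intervalIntegral.integral_add (intervalIntegrable_unitWeight hlam p)
    (intervalIntegrable_unitWeight hlam q)

lemma unitIntegral_C_mul (c : ℝ) (p : ℝ[X]) :
    unitIntegral lam (C c * p) = c * unitIntegral lam p := by
  simp only [unitIntegral, eval_mul, eval_C, mul_assoc]
  exact intervalIntegral.integral_const_mul _ _

lemma unitIntegral_zero : unitIntegral lam 0 = 0 := by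
  simp [unitIntegral]

lemma unitIntegral_sum (hlam : -1 / 2 < lam) {ι : Type*} (s : Finset ι) (p : ι → ℝ[X]) :
    unitIntegral lam (∑ i ∈ s, p i) = ∑ i ∈ s, unitIntegral lam (p i) := by
  classical
  induction s using Finset.induction_on with
  | empty => simp [unitIntegral_zero]
  | insert a s ha ih => rw [sum_insert ha, sum_insert ha, unitIntegral_add hlam, ih]

lemma unitIntegral_comp_one_sub (p : ℝ[X]) :
    unitIntegral lam (p.comp (1 - X)) = unitIntegral lam p := by
  have h := intervalIntegral.integral_comp_sub_left (a := 0) (b := 1)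
    (fun x => p.eval x * (x * (1 - x)) ^ (lam - 1 / 2)) 1
  simp only [sub_zero, sub_self] at h
  rw [unitIntegral, unitIntegral, ← h]
  refine intervalIntegral.integral_congr fun x _ => ?_
  simp only [eval_comp, eval_sub, eval_one, eval_X]
  ring_nf

lemma unitIntegral_X_pow_mul_one_sub_X_pow (hlam : -1 / 2 < lam) (a b : ℕ) :
    unitIntegral lam (X ^ a * (1 - X) ^ b) =
      Real.Gamma (lam + 1 / 2 + a) * Real.Gamma (lam + 1 / 2 + b) /
        Real.Gamma (a + b + 2 * lam + 1) := by
  have hl : 0 < lam + 1 / 2 := by linarith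
  rw [show (a : ℝ) + b + 2 * lam + 1 = (lam + 1 / 2 + a) + (lam + 1 / 2 + b) by ring,
    ← integral_rpow_mul_one_sub_rpow (by positivity) (by positivity), unitIntegral,
    intervalIntegral.integral_of_le (by norm_num), intervalIntegral.integral_of_le (by norm_num),
    MeasureTheory.integral_Ioc_eq_integral_Ioo, MeasureTheory.integral_Ioc_eq_integral_Ioo]
  -- The endpoints are dropped because splitting the exponents with `Real.rpow_add` needs positive
  -- bases.
  refine MeasureTheory.setIntegral_congr_fun measurableSet_Ioo fun x hx => ?_
  have h1 : 0 < 1 - x := by linarith [hx.2]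
  simp only [eval_mul, eval_pow, eval_sub, eval_one, eval_X]
  rw [Real.mul_rpow hx.1.le h1.le, show lam + 1 / 2 + a - 1 = a + (lam - 1 / 2) by ring,
    show lam + 1 / 2 + b - 1 = b + (lam - 1 / 2) by ring, Real.rpow_add hx.1, Real.rpow_add h1,
    Real.rpow_natCast, Real.rpow_natCast]
  ring

end UnitIntegral

end Moments

section OrthogonalPolynomials

open Polynomial Finset

/-! ### Ultraspherical polynomials shifted to the unit interval -/

/-- The ultraspherical polynomial of degree `n` in the variable `(1 - x) / 2`, normalized by
the value `1` at zero. -/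
noncomputable def shiftedUltra (lam : ℝ) (n : ℕ) : ℝ[X] :=
  ∑ k ∈ range (n + 1), C ((-1) ^ k * (n.choose k : ℝ) *
    (risingFactorial (n + 2 * lam) k / risingFactorial (lam + 1 / 2) k)) * X ^ k

/-- The leading coefficient of `(-1) ^ n • shiftedUltra lam n`. -/
noncomputable def shiftedUltraLead (lam : ℝ) (n : ℕ) : ℝ :=
  risingFactorial (n + 2 * lam) n / risingFactorial (lam + 1 / 2) n

section ShiftedUltra

variable {lam : ℝ}

lemma shiftedUltraLead_pos (hlam : -1 / 2 < lam) (n : ℕ) : 0 < shiftedUltraLead lam n := by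
  refine div_pos ?_ (risingFactorial_pos (by linarith) n)
  -- For `n = 0` the base `2 * lam` may be negative, but the product is empty.
  rcases n with _ | n
  · simp [risingFactorial_zero]
  · refine risingFactorial_pos ?_ _
    have : (0 : ℝ) ≤ n := n.cast_nonneg
    push_cast; linarith

lemma natDegree_shiftedUltra_le (n : ℕ) : (shiftedUltra lam n).natDegree ≤ n :=
  natDegree_sum_le_of_forall_le _ _ fun k hk =>
    (natDegree_C_mul_X_pow_le _ _).trans (by have := mem_range.1 hk; omega)

lemma coeff_shiftedUltra_self (n : ℕ) :
    (shiftedUltra lam n).coeff n = (-1) ^ n * shiftedUltraLead lam n := by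
  simp only [shiftedUltra, finsetSum_coeff, coeff_C_mul_X_pow, shiftedUltraLead]
  simp

/-- Each power of `X` contributes a Beta integral. The factor `(lam + 1/2)_k` from its Gamma
function cancels the denominator of the coefficient, leaving a Chu-Vandermonde sum with `b = n + 2
lam`, `c = m + 2 lam + 1`. -/
lemma unitIntegral_shiftedUltra_mul_pow (hlam : -1 / 2 < lam) (n m : ℕ) :
    unitIntegral lam (shiftedUltra lam n * (1 - X) ^ m) =
      Real.Gamma (lam + 1 / 2) * Real.Gamma (lam + 1 / 2 + m) * m.descFactorial n /
        Real.Gamma (n + m + 2 * lam + 1) := by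
  have hl : 0 < lam + 1 / 2 := by linarith
  have hm : (0 : ℝ) < m + 2 * lam + 1 := by
    have : (0 : ℝ) ≤ m := m.cast_nonneg
    linarith
  have hΓ := (Real.Gamma_pos_of_pos hm).ne'
  have hterm : ∀ k, unitIntegral lam (C ((-1) ^ k * (n.choose k : ℝ) *
      (risingFactorial (n + 2 * lam) k / risingFactorial (lam + 1 / 2) k)) * X ^ k *
        (1 - X) ^ m) = Real.Gamma (lam + 1 / 2) * Real.Gamma (lam + 1 / 2 + m) /
          Real.Gamma (m + 2 * lam + 1) * ((-1) ^ k * (n.choose k : ℝ) *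
      (risingFactorial (n + 2 * lam) k / risingFactorial (m + 2 * lam + 1) k)) := fun k => by
    rw [mul_assoc (C _), unitIntegral_C_mul, unitIntegral_X_pow_mul_one_sub_X_pow hlam,
      Gamma_add_natCast hl, show (k : ℝ) + m + 2 * lam + 1 = m + 2 * lam + 1 + k by ring,
      Gamma_add_natCast hm]
    have h1 := (risingFactorial_pos hl k).ne'
    have h2 := (risingFactorial_pos hm k).ne'
    generalize risingFactorial (lam + 1 / 2) k = A at *
    field_simp
  rw [shiftedUltra, sum_mul, unitIntegral_sum hlam, sum_congr rfl fun k _ => hterm k, ← mul_sum,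
    sum_choose_mul_risingFactorial_div _ _ _ hm,
    show (m : ℝ) + 2 * lam + 1 - (n + 2 * lam) = m + 1 - n by ring, risingFactorial_sub_natCast,
    show (n : ℝ) + m + 2 * lam + 1 = m + 2 * lam + 1 + n by ring, Gamma_add_natCast hm]
  have h2 := (risingFactorial_pos hm n).ne'
  field_simp

/-- The pairing of `shiftedUltra lam n` with `(1 - X) ^ n`. -/
noncomputable def shiftedUltraMoment (lam : ℝ) (n : ℕ) : ℝ :=
  Real.Gamma (lam + 1 / 2) * Real.Gamma (lam + 1 / 2 + n) * n.factorial /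
    Real.Gamma (2 * n + 2 * lam + 1)

lemma shiftedUltraMoment_pos (hlam : -1 / 2 < lam) (n : ℕ) : 0 < shiftedUltraMoment lam n := by
  have hl : 0 < lam + 1 / 2 := by linarith
  have hn : (0 : ℝ) ≤ n := n.cast_nonneg
  have := Real.Gamma_pos_of_pos hl
  have := Real.Gamma_pos_of_pos (show 0 < lam + 1 / 2 + n by positivity)
  have := Real.Gamma_pos_of_pos (show 0 < 2 * n + 2 * lam + 1 by linarith)
  have := Nat.factorial_pos n
  rw [shiftedUltraMoment]
  positivity

/-- Expanding in powers of `1 - X`, only the top power has a nonzero moment. -/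
lemma unitIntegral_shiftedUltra_mul_comp (hlam : -1 / 2 < lam) (n : ℕ) (q : ℝ[X])
    (hq : q.natDegree ≤ n) :
    unitIntegral lam (shiftedUltra lam n * q.comp (1 - X)) =
      q.coeff n * shiftedUltraMoment lam n := by
  have e : q.comp (1 - X) = ∑ m ∈ range (n + 1), C (q.coeff m) * (1 - X) ^ m := by
    conv_lhs => rw [q.as_sum_range_C_mul_X_pow' (Nat.lt_succ_of_le hq)]
    simp [Polynomial.sum_comp]
  rw [e, mul_sum, unitIntegral_sum hlam, sum_range_succ, sum_eq_zero, zero_add]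
  · rw [mul_left_comm, unitIntegral_C_mul, unitIntegral_shiftedUltra_mul_pow hlam,
      Nat.descFactorial_self, shiftedUltraMoment]
    ring_nf
  · intro m hm
    rw [mul_left_comm, unitIntegral_C_mul, unitIntegral_shiftedUltra_mul_pow hlam,
      Nat.descFactorial_of_lt (mem_range.1 hm)]
    simp

end ShiftedUltra

/-! ### Identification of the monic orthogonal polynomials -/

section Monic

variable {lam : ℝ}

/-- Under `x ↦ 2x - 1` the weight becomes `(4 x (1 - x)) ^ (lam - 1/2)`; together with the Jacobian,
the constant is `2 * 4 ^ (lam - 1/2) = 2 ^ (2 lam)`. -/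
lemma ultraInner_eq_unitIntegral (p q : ℝ[X]) :
    ultraInner lam p q = 2 ^ (2 * lam) * unitIntegral lam ((p * q).comp (C 2 * X - 1)) := by
  have h := intervalIntegral.integral_comp_mul_sub (a := 0) (b := 1) (c := (2 : ℝ))
    (fun x => p.eval x * q.eval x * (1 - x ^ 2) ^ (lam - 1 / 2)) (by norm_num) 1
  norm_num at h
  rw [ultraInner]
  simp only [one_div] at *
  have h' : (∫ x in (-1 : ℝ)..1, p.eval x * q.eval x * (1 - x ^ 2) ^ (lam - 2⁻¹)) =
    2 * ∫ x in (0 : ℝ)..1, p.eval (2 * x - 1) * q.eval (2 * x - 1) *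
      (1 - (2 * x - 1) ^ 2) ^ (lam - 2⁻¹) := by rw [h]; ring
  rw [h', unitIntegral, ← intervalIntegral.integral_const_mul,
    ← intervalIntegral.integral_const_mul]
  refine intervalIntegral.integral_congr fun x hx => ?_
  rw [Set.uIcc_of_le (by norm_num)] at hx
  have h0 : 0 ≤ x * (1 - x) := mul_nonneg hx.1 (by linarith [hx.2])
  simp only [eval_comp, eval_mul, eval_sub, eval_one, eval_X, eval_C]
  rw [show 1 - (2 * x - 1) ^ 2 = 4 * (x * (1 - x)) by ring, Real.mul_rpow (by norm_num) h0,
    show (4 : ℝ) = 2 ^ (2 : ℝ) by norm_num, ← Real.rpow_mul (by norm_num),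
    show (2 : ℝ) * lam = 1 + 2 * (lam - 2⁻¹) by ring, Real.rpow_add (by norm_num), Real.rpow_one]
  ring_nf

lemma ultraInner_add_right (hlam : -1 / 2 < lam) (p q r : ℝ[X]) :
    ultraInner lam p (q + r) = ultraInner lam p q + ultraInner lam p r := by
  simp only [ultraInner_eq_unitIntegral, mul_add, add_comp, unitIntegral_add hlam]

lemma ultraInner_C_mul_right (c : ℝ) (p q : ℝ[X]) :
    ultraInner lam p (C c * q) = c * ultraInner lam p q := by
  simp only [ultraInner_eq_unitIntegral, mul_left_comm p, mul_comp, C_comp,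
    unitIntegral_C_mul]
  ring

lemma ultraInner_comm (p q : ℝ[X]) : ultraInner lam p q = ultraInner lam q p := by
  simp only [ultraInner, mul_comm (p.eval _)]

lemma ultraInner_sum_right (hlam : -1 / 2 < lam) {ι : Type*} (s : Finset ι) (p : ℝ[X])
    (q : ι → ℝ[X]) : ultraInner lam p (∑ i ∈ s, q i) = ∑ i ∈ s, ultraInner lam p (q i) := by
  simp only [ultraInner_eq_unitIntegral, mul_sum, Polynomial.sum_comp,
    unitIntegral_sum hlam]

lemma exists_eq_sum_C_mul_of_monic {Q : ℕ → ℝ[X]} (hQ : ∀ n, (Q n).Monic)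
    (hdeg : ∀ n, (Q n).natDegree = n) (n : ℕ) (p : ℝ[X]) (hp : p.degree < n) :
    ∃ c : ℕ → ℝ, p = ∑ m : Fin n, C (c m) * Q m := by
  induction n generalizing p with
  | zero =>
    refine ⟨0, ?_⟩
    simpa using hp
  | succ n ih =>
    have h1 : (p - C (p.coeff n) * Q n).degree < n := by
      rw [degree_lt_iff_coeff_zero]
      intro m hm
      rw [coeff_sub, coeff_C_mul]
      rcases hm.eq_or_lt with rfl | hm
      · have := hQ n
        rw [Monic, leadingCoeff, hdeg] at this
        rw [this]; ring
      · rw [coeff_eq_zero_of_degree_lt (hp.trans_le (by exact_mod_cast hm)),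
          coeff_eq_zero_of_natDegree_lt (p := Q n) (by rw [hdeg]; exact hm)]
        ring
    obtain ⟨c, hc⟩ := ih _ h1
    refine ⟨fun m => if m = n then p.coeff n else c m, ?_⟩
    rw [Fin.sum_univ_castSucc]
    have : ∀ m : Fin n, (m : ℕ) ≠ n := fun m => m.isLt.ne
    simp only [Fin.val_castSucc, Fin.val_last, this, if_true, if_false, ← hc]
    ring

/-- Monic polynomials that are orthogonal to all polynomials of lower degree come from
Gram-Schmidt orthogonalization. -/
lemma ultraMonic_eq_of_orthogonal (hlam : -1 / 2 < lam) {Q : ℕ → ℝ[X]} (hQ : ∀ n, (Q n).Monic)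
    (hdeg : ∀ n, (Q n).natDegree = n)
    (horth : ∀ (n : ℕ) (p : ℝ[X]), p.degree < n → ultraInner lam (Q n) p = 0)
    (hne : ∀ n, ultraInner lam (Q n) (Q n) ≠ 0) (n : ℕ) : ultraMonic lam n = Q n := by
  induction n using Nat.strong_induction_on with
  | _ n ih =>
    have hd : ∀ m, (Q m).degree = m := fun m => by
      rw [degree_eq_natDegree (hQ m).ne_zero, hdeg]
    have hlt : ((X : ℝ[X]) ^ n - Q n).degree < (n : WithBot ℕ) := by
      have h := degree_sub_lt_left (p := (X : ℝ[X]) ^ n) (q := Q n) (by rw [degree_X_pow, hd])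
        (pow_ne_zero n X_ne_zero) (by rw [(monic_X_pow n).leadingCoeff, (hQ n).leadingCoeff])
      rwa [degree_X_pow] at h
    obtain ⟨c, hc⟩ := exists_eq_sum_C_mul_of_monic hQ hdeg n _ hlt
    -- Pairing `X ^ n = Q n + ∑ c m Q m` with `Q m` isolates `c m`, which is exactly the
    -- Gram-Schmidt coefficient.
    have hcoef : ∀ m : Fin n, c m = ultraInner lam (X ^ n) (Q m) / ultraInner lam (Q m) (Q m) := by
      intro m
      rw [eq_div_iff (hne m), show (X : ℝ[X]) ^ n = Q n + ∑ m : Fin n, C (c m) * Q m by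
        rw [← hc]; ring, ultraInner_comm (_ + _), ultraInner_add_right hlam,
        ultraInner_sum_right hlam, ultraInner_comm _ (Q n), horth n (Q m) (by rw [hd]; exact_mod_cast m.isLt),
        zero_add,
        Finset.sum_eq_single m]
      · rw [ultraInner_C_mul_right]
      · intro l _ hl
        rw [ultraInner_C_mul_right]
        rcases lt_or_gt_of_ne (fun h => hl (Fin.ext h) : (l : ℕ) ≠ m) with h | h
        · rw [horth m (Q l) (by rw [hd]; exact_mod_cast h), mul_zero]
        · rw [ultraInner_comm, horth l (Q m) (by rw [hd]; exact_mod_cast h), mul_zero]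
      · simp
    rw [ultraMonic]
    have : ∀ m : Fin n, C (ultraInner lam (X ^ n) (ultraMonic lam m) /
        ultraInner lam (ultraMonic lam m) (ultraMonic lam m)) * ultraMonic lam m =
        C (c m) * Q m := fun m => by
      rw [ih m m.isLt, hcoef]
    rw [sum_congr rfl fun m _ => this m, ← hc]
    ring

end Monic

end OrthogonalPolynomials

/-! ### Orthonormal polynomials and the coefficient as a terminating sum -/

section ExactIntegral

open Polynomial Finset

section Orthonormal

variable {lam : ℝ}

lemma coeff_comp_linear {p : ℝ[X]} {n : ℕ} (hp : p.natDegree ≤ n) (a : ℝ) {b : ℝ} (hb : b ≠ 0) :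
    (p.comp (C b * X + C a)).coeff n = b ^ n * p.coeff n := by
  have hd : (C b * X + C a).natDegree = 1 := natDegree_linear hb
  rcases hp.eq_or_lt with rfl | hlt
  · have h := coeff_comp_degree_mul_degree (p := p) (q := C b * X + C a)
      (by rw [hd]; exact one_ne_zero)
    rw [hd, mul_one, leadingCoeff_linear hb] at h
    rw [h, leadingCoeff, mul_comm]
  · rw [coeff_eq_zero_of_natDegree_lt hlt, coeff_eq_zero_of_natDegree_lt, mul_zero]
    rwa [natDegree_comp, hd, mul_one]

/-- The monic ultraspherical polynomial, expanded around `x = -s` for a sign `s`. -/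
noncomputable def signedUltra (lam s : ℝ) (n : ℕ) : ℝ[X] :=
  C ((-2 * s) ^ n / shiftedUltraLead lam n) *
    (shiftedUltra lam n).comp (C (s / 2) * X + C (1 / 2))

lemma natDegree_signedUltra_le (s : ℝ) (hs : s ≠ 0) (n : ℕ) :
    (signedUltra lam s n).natDegree ≤ n := by
  refine (natDegree_C_mul_le _ _).trans ?_
  rw [natDegree_comp, natDegree_linear (by positivity), mul_one]
  exact natDegree_shiftedUltra_le n

lemma coeff_signedUltra_self (hlam : -1 / 2 < lam) {s : ℝ} (hs : s ^ 2 = 1) (n : ℕ) :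
    (signedUltra lam s n).coeff n = 1 := by
  have hs0 : s ≠ 0 := by rintro rfl; norm_num at hs
  rw [signedUltra, coeff_C_mul, coeff_comp_linear (natDegree_shiftedUltra_le n) _ (by positivity),
    coeff_shiftedUltra_self]
  have h := (shiftedUltraLead_pos hlam n).ne'
  have h2 : (-2 * s) ^ n * (s / 2) ^ n * (-1) ^ n = 1 := by
    rw [← mul_pow, ← mul_pow, show -2 * s * (s / 2) * -1 = s ^ 2 by ring, hs, one_pow]
  field_simp
  linear_combination h2

lemma monic_signedUltra (hlam : -1 / 2 < lam) {s : ℝ} (hs : s ^ 2 = 1) (n : ℕ) :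
    (signedUltra lam s n).Monic :=
  monic_of_natDegree_le_of_coeff_eq_one n
    (natDegree_signedUltra_le s (by rintro rfl; norm_num at hs) n) (coeff_signedUltra_self hlam hs n)

lemma natDegree_signedUltra (hlam : -1 / 2 < lam) {s : ℝ} (hs : s ^ 2 = 1) (n : ℕ) :
    (signedUltra lam s n).natDegree = n :=
  natDegree_eq_of_le_of_coeff_ne_zero
    (natDegree_signedUltra_le s (by rintro rfl; norm_num at hs) n)
    (by rw [coeff_signedUltra_self hlam hs]; exact one_ne_zero)

/-- On `[0, 1]` the sign `s = 1` gives `shiftedUltra` itself and `s = -1` its reflection, so the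
moment formula applies to both. Since only the coefficient of degree `n` enters, orthogonality and
the norm follow together. -/
lemma ultraInner_signedUltra (hlam : -1 / 2 < lam) {s : ℝ} (hs : s ^ 2 = 1) (n : ℕ) (p : ℝ[X])
    (hp : p.natDegree ≤ n) :
    ultraInner lam (signedUltra lam s n) p =
      p.coeff n * (2 ^ (2 * lam) * 4 ^ n * shiftedUltraMoment lam n / shiftedUltraLead lam n) := by
  have key : unitIntegral lam (((shiftedUltra lam n).comp (C (s / 2) * X + C (1 / 2))).comp
      (C 2 * X - 1) * p.comp (C 2 * X - 1)) =
        (-2 * s) ^ n * p.coeff n * shiftedUltraMoment lam n := by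
    rcases (sq_eq_sq_iff_eq_or_eq_neg.1 (hs.trans (one_pow 2).symm)) with rfl | rfl
    · have e1 : ((shiftedUltra lam n).comp (C ((1 : ℝ) / 2) * X + C (1 / 2))).comp
          (C 2 * X - 1) = shiftedUltra lam n := by
        rw [comp_assoc]
        conv_rhs => rw [← comp_X (p := shiftedUltra lam n)]
        congr 1
        refine funext fun x => ?_
        simp; ring
      have e2 : p.comp (C 2 * X - 1) = (p.comp (C (-2) * X + C 1)).comp (1 - X) := by
        rw [comp_assoc]
        congr 1
        refine funext fun x => ?_
        simp; ring
      rw [e1, e2, unitIntegral_shiftedUltra_mul_comp hlam, coeff_comp_linear hp _ (by norm_num)]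
      · ring
      · rwa [natDegree_comp, natDegree_linear (by norm_num), mul_one]
    · rw [← unitIntegral_comp_one_sub, mul_comp]
      have e1 : (((shiftedUltra lam n).comp (C ((-1 : ℝ) / 2) * X + C (1 / 2))).comp
          (C 2 * X - 1)).comp (1 - X) = shiftedUltra lam n := by
        rw [comp_assoc, comp_assoc]
        conv_rhs => rw [← comp_X (p := shiftedUltra lam n)]
        congr 1
        refine funext fun x => ?_
        simp; ring
      have e2 : p.comp (C 2 * X - 1) = p.comp (C 2 * X + C (-1)) := by
        simp [sub_eq_add_neg]
      rw [e1, e2, unitIntegral_shiftedUltra_mul_comp hlam, coeff_comp_linear hp _ (by norm_num)]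
      · ring
      · rwa [natDegree_comp, natDegree_linear (by norm_num), mul_one]
  have h := (shiftedUltraLead_pos hlam n).ne'
  rw [ultraInner_eq_unitIntegral, signedUltra, mul_comp, mul_comp, C_comp, mul_assoc,
    unitIntegral_C_mul, key]
  have h4 : (-2 * s) ^ n * (-2 * s) ^ n = 4 ^ n := by
    rw [← mul_pow, show -2 * s * (-2 * s) = 4 * s ^ 2 by ring, hs, mul_one]
  field_simp
  linear_combination p.coeff n * shiftedUltraMoment lam n * h4

lemma ultraInner_signedUltra_self_pos (hlam : -1 / 2 < lam) {s : ℝ} (hs : s ^ 2 = 1) (n : ℕ) :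
    0 < ultraInner lam (signedUltra lam s n) (signedUltra lam s n) := by
  rw [ultraInner_signedUltra hlam hs n _ (natDegree_signedUltra hlam hs n).le,
    coeff_signedUltra_self hlam hs]
  have := shiftedUltraMoment_pos hlam n
  have := shiftedUltraLead_pos hlam n
  positivity

/-- Uniqueness of monic orthogonal polynomials allows either sign. This replaces the parity relation
and leaves the expansion point free: `s = -1` serves degree `i`, `s = 1` serves degree `j`. -/
lemma ultraMonic_eq_signedUltra (hlam : -1 / 2 < lam) {s : ℝ} (hs : s ^ 2 = 1) (n : ℕ) :
    ultraMonic lam n = signedUltra lam s n := by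
  refine ultraMonic_eq_of_orthogonal hlam (monic_signedUltra hlam hs)
    (natDegree_signedUltra hlam hs) (fun n p hp => ?_)
    (fun n => (ultraInner_signedUltra_self_pos hlam hs n).ne') n
  rw [ultraInner_signedUltra hlam hs n p (natDegree_le_of_degree_le hp.le),
    coeff_eq_zero_of_degree_lt hp, zero_mul]

/-- The squared norm of the normalized polynomial `shiftedUltra`. -/
noncomputable def shiftedUltraNormSq (lam : ℝ) (n : ℕ) : ℝ :=
  2 ^ (2 * lam) * (shiftedUltraMoment lam n * shiftedUltraLead lam n)

lemma shiftedUltraNormSq_pos (hlam : -1 / 2 < lam) (n : ℕ) : 0 < shiftedUltraNormSq lam n := by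
  have := shiftedUltraMoment_pos hlam n
  have := shiftedUltraLead_pos hlam n
  rw [shiftedUltraNormSq]
  positivity

lemma ultraOrthonormal_eq (hlam : -1 / 2 < lam) {s : ℝ} (hs : s ^ 2 = 1) (n : ℕ) :
    ultraOrthonormal lam n = C ((-s) ^ n / Real.sqrt (shiftedUltraNormSq lam n)) *
      (shiftedUltra lam n).comp (C (s / 2) * X + C (1 / 2)) := by
  have hlead := shiftedUltraLead_pos hlam n
  rw [ultraOrthonormal, ultraMonic_eq_signedUltra hlam hs,
    ultraInner_signedUltra hlam hs n _ (natDegree_signedUltra hlam hs n).le,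
    coeff_signedUltra_self hlam hs, signedUltra, ← mul_assoc, ← C_mul]
  congr 2
  have e : 1 * (2 ^ (2 * lam) * 4 ^ n * shiftedUltraMoment lam n / shiftedUltraLead lam n) =
      shiftedUltraNormSq lam n * (2 ^ n / shiftedUltraLead lam n) ^ 2 := by
    rw [shiftedUltraNormSq, show (4 : ℝ) = 2 ^ 2 by norm_num, ← pow_mul]
    field_simp
    ring
  rw [e, Real.sqrt_mul (shiftedUltraNormSq_pos hlam n).le, Real.sqrt_sq (by positivity),
    show -2 * s = 2 * -s by ring, mul_pow]
  have := Real.sqrt_pos.2 (shiftedUltraNormSq_pos hlam n)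
  field_simp

/-- Both rising factorials cancel against Gamma functions. The condition `1 ≤ n` keeps `n + 2 * lam`
positive. -/
lemma shiftedUltraNormSq_eq (hlam : -1 / 2 < lam) {n : ℕ} (hn : 1 ≤ n) :
    shiftedUltraNormSq lam n = 2 ^ (2 * lam) * Real.Gamma (lam + 1 / 2) ^ 2 * n.factorial /
      (2 * (n + lam) * Real.Gamma (n + 2 * lam)) := by
  have hn' : (1 : ℝ) ≤ n := by exact_mod_cast hn
  have hl : 0 < lam + 1 / 2 := by linarith
  have h1 : (0 : ℝ) < n + 2 * lam := by linarith
  have h3 : (0 : ℝ) < n + lam := by linarith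
  have g1 := Real.Gamma_pos_of_pos hl
  have g2 := Real.Gamma_pos_of_pos h1
  have r1 := risingFactorial_pos hl n
  have r2 := risingFactorial_pos h1 n
  rw [shiftedUltraNormSq, shiftedUltraMoment, shiftedUltraLead, Gamma_add_natCast hl,
    Real.Gamma_add_one (by linarith), show (2 : ℝ) * n + 2 * lam = n + 2 * lam + n by ring,
    Gamma_add_natCast h1, show (n : ℝ) + 2 * lam + n = 2 * (n + lam) by ring]
  generalize lam + 1 / 2 = A at *
  generalize (n : ℝ) + 2 * lam = B at *
  field_simp

/-- Expanding the degree `i` factor in powers of `(1 - x) / 2` turns every term into a known moment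
of `shiftedUltra lam j`. -/
lemma ultraCoeff_eq_sum (hlam : -1 / 2 < lam) (i j : ℕ) :
    ultraCoeff lam i j = (-1) ^ j * Real.Gamma (lam + 1 / 2) ^ 2 /
        (Real.sqrt (shiftedUltraNormSq lam i) * Real.sqrt (shiftedUltraNormSq lam j)) *
      ∑ k ∈ range (i + 1), (-1) ^ k * (i.choose k : ℝ) * risingFactorial (i + 2 * lam) k *
        (1 / 2) ^ k * k.descFactorial j / Real.Gamma (j + k + 2 * lam + 1) := by
  have hl : 0 < lam + 1 / 2 := by linarith
  have e0 : ultraCoeff lam i j =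
      unitIntegral lam (ultraOrthonormal lam i * (ultraOrthonormal lam j).comp (C 2 * X - 1)) := by
    simp [ultraCoeff, unitIntegral]
  have e1 : ((shiftedUltra lam j).comp (C ((1 : ℝ) / 2) * X + C (1 / 2))).comp
      (C 2 * X - 1) = shiftedUltra lam j := by
    rw [comp_assoc]
    conv_rhs => rw [← comp_X (p := shiftedUltra lam j)]
    congr 1
    refine funext fun x => ?_
    simp; ring
  have e2 : (shiftedUltra lam i).comp (C ((-1 : ℝ) / 2) * X + C (1 / 2)) =
      ∑ k ∈ range (i + 1), C ((-1) ^ k * (i.choose k : ℝ) *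
        (risingFactorial (i + 2 * lam) k / risingFactorial (lam + 1 / 2) k) * (1 / 2) ^ k) *
          (1 - X) ^ k := by
    have : (C ((-1 : ℝ) / 2) * X + C (1 / 2)) = C (1 / 2) * (1 - X) :=
      funext fun x => by simp; ring
    rw [this, shiftedUltra, Polynomial.sum_comp]
    refine sum_congr rfl fun k _ => ?_
    rw [mul_comp, C_comp, pow_comp, X_comp, mul_pow, ← C_pow, ← mul_assoc, ← C_mul]
  rw [e0, ultraOrthonormal_eq hlam (s := -1) (by norm_num) i,
    ultraOrthonormal_eq hlam (s := 1) (by norm_num) j, mul_comp, C_comp, e1, e2, mul_assoc,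
    unitIntegral_C_mul, mul_left_comm, unitIntegral_C_mul, sum_mul, unitIntegral_sum hlam]
  have hterm : ∀ k, unitIntegral lam (C ((-1) ^ k * (i.choose k : ℝ) *
      (risingFactorial (i + 2 * lam) k / risingFactorial (lam + 1 / 2) k) * (1 / 2) ^ k) *
        (1 - X) ^ k * shiftedUltra lam j) = Real.Gamma (lam + 1 / 2) ^ 2 *
      ((-1) ^ k * (i.choose k : ℝ) * risingFactorial (i + 2 * lam) k *
        (1 / 2) ^ k * k.descFactorial j / Real.Gamma (j + k + 2 * lam + 1)) := fun k => by
    rw [mul_assoc, unitIntegral_C_mul, mul_comm (_ ^ _) (shiftedUltra _ _),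
      unitIntegral_shiftedUltra_mul_pow hlam, Gamma_add_natCast hl]
    have r1 := (risingFactorial_pos hl k).ne'
    generalize lam + 1 / 2 = A at *
    field_simp
  rw [sum_congr rfl fun k _ => hterm k, ← mul_sum]
  simp only [neg_neg, one_pow]
  ring

end Orthonormal

end ExactIntegral

/-! ### The coefficient as a Taylor coefficient of a product of binomials -/

section ExactFormula

open Finset

lemma ringChoose_add_natCast_sub_one (a : ℝ) (k : ℕ) :
    Ring.choose (a + k - 1) k = risingFactorial a k / k.factorial := by
  have h1 : ∀ k, (ascPochhammer ℝ k).eval a = risingFactorial a k := fun k => by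
    induction k with
    | zero => simp [risingFactorial_zero]
    | succ k ih => rw [ascPochhammer_succ_right, risingFactorial_succ, Polynomial.eval_mul, ih]; simp
  have h := Ring.factorial_nsmul_multichoose_eq_ascPochhammer a k
  rw [Polynomial.ascPochhammer_smeval_eq_eval, h1, Ring.multichoose_eq, nsmul_eq_mul] at h
  rw [← h, mul_div_cancel_left₀ _ (by exact_mod_cast k.factorial_ne_zero)]

/-- The coefficient of `z ^ p` in `(1 + z) ^ s * (1 - z) ^ (p + 1)`, obtained by writing
`1 - z = 2 - (1 + z)`. -/
noncomputable def binomialProductCoeff (s : ℝ) (p : ℕ) : ℝ :=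
  ∑ m ∈ range (p + 2), (-1) ^ m * ((p + 1).choose m : ℝ) * 2 ^ (p + 1 - m) * Ring.choose (s + m) p

/-- The terms with `k < j` vanish. For `k = j + m` the rising factorial divided by the Gamma
function is a product of `p` consecutive factors, hence a generalized binomial coefficient, and the
integer factors reduce to `(p + 1).choose m`. -/
lemma sum_eq_binomialProductCoeff {lam : ℝ} (hlam : -1 / 2 < lam) {j : ℕ} (hj : 1 ≤ j) (p : ℕ) :
    ∑ k ∈ range (j + p + 1 + 1), (-1) ^ k * ((j + p + 1).choose k : ℝ) *
        risingFactorial ((j + p + 1 : ℕ) + 2 * lam) k *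
        (1 / 2) ^ k * k.descFactorial j / Real.Gamma (j + k + 2 * lam + 1) =
      (-1) ^ j * (1 / 2) ^ (j + p + 1) * ((j + p + 1).factorial / (p + 1)) /
        Real.Gamma ((j + p + 1 : ℕ) + 2 * lam) *
        binomialProductCoeff (2 * j + p + 2 * lam) p := by
  have hj' : (1 : ℝ) ≤ j := by exact_mod_cast hj
  have hp' : (0 : ℝ) ≤ p := p.cast_nonneg
  rw [show j + p + 1 + 1 = j + (p + 2) by ring, sum_range_add, sum_eq_zero, zero_add,
    binomialProductCoeff, mul_sum]
  · refine sum_congr rfl fun m hm => ?_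
    have hm' : m ≤ p + 1 := Nat.lt_succ_iff.1 (mem_range.1 hm)
    have hm0 : (0 : ℝ) ≤ m := m.cast_nonneg
    have hB : (0 : ℝ) < 2 * j + m + 2 * lam + 1 := by linarith
    have hI : (0 : ℝ) < (j + p + 1 : ℕ) + 2 * lam := by push_cast; linarith
    have gB := (Real.Gamma_pos_of_pos hB).ne'
    have gI := (Real.Gamma_pos_of_pos hI).ne'
    have e1 : risingFactorial ((j + p + 1 : ℕ) + 2 * lam) (j + m) =
        risingFactorial (2 * j + m + 2 * lam + 1) p * Real.Gamma (2 * j + m + 2 * lam + 1) /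
          Real.Gamma ((j + p + 1 : ℕ) + 2 * lam) := by
      rw [← Gamma_add_natCast hB, eq_div_iff gI, ← Gamma_add_natCast hI]
      push_cast
      ring_nf
    have e2 : Ring.choose ((2 * j + p + 2 * lam : ℝ) + m) p =
        risingFactorial (2 * j + m + 2 * lam + 1) p / p.factorial := by
      rw [← ringChoose_add_natCast_sub_one]
      ring_nf
    have e3 : ((j + p + 1).choose (j + m) : ℝ) * (j + m).descFactorial j * (p + 1).factorial =
        (j + p + 1).factorial * (p + 1).choose m := by
      have h1 := Nat.choose_mul (n := j + p + 1) (k := j + m) (s := j) (by omega)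
      rw [show j + p + 1 - j = p + 1 by omega, show j + m - j = m by omega] at h1
      have h2 : (j + m).descFactorial j = j.factorial * (j + m).choose j :=
        Nat.descFactorial_eq_factorial_mul_choose _ _
      have h3 := Nat.choose_mul_factorial_mul_factorial (n := j + p + 1) (k := j) (by omega)
      rw [show j + p + 1 - j = p + 1 by omega] at h3
      have : (j + p + 1).choose (j + m) * (j + m).descFactorial j * (p + 1).factorial =
        (j + p + 1).factorial * (p + 1).choose m := by
        rw [h2, ← h3]
        linear_combination (j.factorial * (p + 1).factorial) * h1
      exact_mod_cast this
    have e4 : ((1 : ℝ) / 2) ^ (j + m) = (1 / 2) ^ (j + p + 1) * 2 ^ (p + 1 - m) := by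
      obtain ⟨d, hd⟩ := Nat.exists_eq_add_of_le hm'
      rw [show j + p + 1 = j + m + d by omega, show p + 1 - m = d by omega, pow_add _ (j + m) d,
        mul_assoc, ← mul_pow]
      norm_num
    have e5 : ((p + 1).factorial : ℝ) = (p + 1) * p.factorial := by
      rw [Nat.factorial_succ]; push_cast; ring
    have f1 : (p.factorial : ℝ) ≠ 0 := by exact_mod_cast p.factorial_ne_zero
    have e6 : ((j + p + 1).choose (j + m) : ℝ) * (j + m).descFactorial j =
        (j + p + 1).factorial * (p + 1).choose m / ((p + 1) * p.factorial) := by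
      rw [← e5, eq_div_iff (by rw [e5]; positivity), e3]
    rw [e1, e2, e4, show (j : ℝ) + (j + m : ℕ) + 2 * lam + 1 = 2 * j + m + 2 * lam + 1 by
      push_cast; ring, pow_add (-1 : ℝ) j m]
    generalize (1 / 2 : ℝ) ^ (j + p + 1) = H at *
    generalize Real.Gamma (2 * j + m + 2 * lam + 1) = G1 at *
    generalize Real.Gamma ((j + p + 1 : ℕ) + 2 * lam) = G2 at *
    generalize risingFactorial (2 * j + m + 2 * lam + 1) p = G3 at *
    generalize ((j + p + 1).choose (j + m) : ℝ) = c1 at *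
    generalize ((j + m).descFactorial j : ℝ) = c2 at *
    have : c1 * c2 * ((p + 1) * p.factorial) = (j + p + 1).factorial * (p + 1).choose m := by
      rw [e6]; field_simp
    field_simp
    linear_combination G3 * H * this
  · intro k hk
    rw [Nat.descFactorial_of_lt (mem_range.1 hk)]
    simp

/-- An exact formula for the coefficients `ultraCoeff lam i j` with `1 ≤ j < i`. -/
theorem ultraCoeff_eq {lam : ℝ} (hlam : -1 / 2 < lam) {i j p : ℕ} (hj : 1 ≤ j)
    (hi : i = j + p + 1) :
    ultraCoeff lam i j = 2 * (1 / 2) ^ i * 2 ^ (-(2 * lam)) *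
      (binomialProductCoeff (i + j + 2 * lam - 1) p / (p + 1)) *
      Real.sqrt ((i + lam) * (j + lam) * (Real.Gamma (j + 2 * lam) / j.factorial) /
        (Real.Gamma (i + 2 * lam) / i.factorial)) := by
  have hj' : (1 : ℝ) ≤ j := by exact_mod_cast hj
  have hi' : (1 : ℝ) ≤ i := by exact_mod_cast (by omega : 1 ≤ i)
  have g0 := Real.Gamma_pos_of_pos (show 0 < lam + 1 / 2 by linarith)
  have g1 := Real.Gamma_pos_of_pos (show 0 < i + 2 * lam by linarith)
  have g2 := Real.Gamma_pos_of_pos (show 0 < j + 2 * lam by linarith)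
  have l1 : 0 < i + lam := by linarith
  have l2 : 0 < j + lam := by linarith
  have fi : (0 : ℝ) < i.factorial := by exact_mod_cast i.factorial_pos
  have fj : (0 : ℝ) < j.factorial := by exact_mod_cast j.factorial_pos
  have hsum := sum_eq_binomialProductCoeff hlam hj p
  rw [← hi] at hsum
  rw [ultraCoeff_eq_sum hlam, hsum, ← Real.sqrt_mul (shiftedUltraNormSq_pos hlam i).le,
    shiftedUltraNormSq_eq hlam hj, shiftedUltraNormSq_eq hlam (by omega : 1 ≤ i),
    show (i : ℝ) + j + 2 * lam - 1 = 2 * j + p + 2 * lam by rw [hi]; push_cast; ring]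
  set A := Real.Gamma (lam + 1 / 2)
  set GI := Real.Gamma (i + 2 * lam)
  set GJ := Real.Gamma (j + 2 * lam)
  set B := binomialProductCoeff (2 * j + p + 2 * lam) p
  have hT : (0 : ℝ) < 2 ^ (2 * lam) := by positivity
  rw [Real.rpow_neg (by norm_num)]
  set T : ℝ := 2 ^ (2 * lam)
  have hS : Real.sqrt ((i + lam) * (j + lam) * (GJ / j.factorial) / (GI / i.factorial)) =
      (T * A ^ 2 * i.factorial) / (2 * GI) / Real.sqrt
        (T * A ^ 2 * i.factorial / (2 * (i + lam) * GI) *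
        (T * A ^ 2 * j.factorial / (2 * (j + lam) * GJ))) := by
    rw [eq_div_iff (Real.sqrt_pos.2 (by positivity)).ne', ← Real.sqrt_mul (by positivity),
      Real.sqrt_eq_iff_mul_self_eq (by positivity) (by positivity)]
    field_simp
  rw [hS]
  have hj1 : ((-1 : ℝ) ^ j) * (-1) ^ j = 1 := by rw [← mul_pow]; norm_num
  have hsq := Real.sqrt_pos.2 (show 0 < T * A ^ 2 * i.factorial / (2 * (i + lam) * GI) *
        (T * A ^ 2 * j.factorial / (2 * (j + lam) * GJ)) by positivity)
  set S := Real.sqrt (T * A ^ 2 * i.factorial / (2 * (i + lam) * GI) *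
        (T * A ^ 2 * j.factorial / (2 * (j + lam) * GJ)))
  generalize (1 / 2 : ℝ) ^ i = H at *
  field_simp
  linear_combination H * B * hj1

end ExactFormula

/-! ### Cauchy integrals over a circle inside the unit disc -/

section ContourIntegral

open Finset MeasureTheory

lemma continuous_one_add_circleMap_cpow {r : ℝ} (hr : 0 < r) (hr1 : r < 1) (a : ℂ) :
    Continuous fun θ : ℝ => (1 + circleMap 0 r θ) ^ a := by
  refine Continuous.cpow (by fun_prop) continuous_const fun θ => ?_
  refine Complex.mem_slitPlane_of_norm_lt_one ?_
  rw [norm_circleMap_zero, abs_of_pos hr]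
  exact hr1

/-- The binomial coefficients as Fourier coefficients of `(1 + z) ^ a` on a circle. -/
lemma integral_one_add_circleMap_cpow {r : ℝ} (hr : 0 < r) (hr1 : r < 1) (a : ℂ) (p : ℕ) :
    ∫ θ in (-Real.pi)..Real.pi, (1 + circleMap 0 r θ) ^ a * ((circleMap 0 r θ)⁻¹) ^ p =
      2 * Real.pi * Ring.choose a p := by
  have hne : ∀ θ, circleMap 0 r θ ≠ 0 := fun θ => circleMap_ne_center hr.ne'
  have hdiff : DifferentiableOn ℂ (fun z : ℂ => (1 + z) ^ a) (Metric.closedBall 0 r) := by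
    intro z hz
    refine DifferentiableAt.differentiableWithinAt ?_
    refine DifferentiableAt.cpow (by fun_prop) (by fun_prop) ?_
    refine Complex.mem_slitPlane_of_norm_lt_one ?_
    simpa using (lt_of_le_of_lt (by simpa using hz) hr1)
  lift r to NNReal using hr.le
  have h1 := hdiff.hasFPowerSeriesOnBall (by exact_mod_cast hr)
  -- Uniqueness of power series: the Cauchy coefficients are the binomial ones.
  have h2 := h1.hasFPowerSeriesAt.eq_formalMultilinearSeries
    (Complex.one_add_cpow_hasFPowerSeriesAt_zero (a := a))
  have h3 := congrArg (fun P => P p fun _ => (1 : ℂ)) h2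
  simp only [cauchyPowerSeries_apply, binomialSeries_apply] at h3
  simp only [circleIntegral, deriv_circleMap, sub_zero, smul_eq_mul, one_div, List.ofFn_const,
    List.prod_replicate, one_pow, mul_one] at h3
  have h4 : (∫ θ in (0 : ℝ)..2 * Real.pi, circleMap 0 r θ * Complex.I *
      ((circleMap 0 r θ)⁻¹ ^ p * ((circleMap 0 r θ)⁻¹ * (1 + circleMap 0 r θ) ^ a))) =
      Complex.I * ∫ θ in (0 : ℝ)..2 * Real.pi,
        (1 + circleMap 0 r θ) ^ a * ((circleMap 0 r θ)⁻¹) ^ p := by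
    rw [← intervalIntegral.integral_const_mul]
    refine intervalIntegral.integral_congr fun θ _ => ?_
    have := hne θ
    field_simp
  rw [h4] at h3
  have hper : Function.Periodic
      (fun θ : ℝ => (1 + circleMap 0 r θ) ^ a * ((circleMap 0 r θ)⁻¹) ^ p) (2 * Real.pi) :=
    fun θ => by simp only [periodic_circleMap 0 r θ]
  have h5 := hper.intervalIntegral_add_eq (-Real.pi) 0
  rw [show -Real.pi + 2 * Real.pi = Real.pi by ring, zero_add] at h5
  rw [h5, ← h3]
  have := Real.pi_ne_zero
  have : (Real.pi : ℂ) ≠ 0 := by exact_mod_cast this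
  field_simp

lemma integral_eq_binomialProductCoeff {r : ℝ} (hr : 0 < r) (hr1 : r < 1) (s : ℝ) (p : ℕ) :
    ∫ θ in (-Real.pi)..Real.pi, (1 + circleMap 0 r θ) ^ (s : ℂ) *
      (1 - circleMap 0 r θ) ^ (p + 1) * ((circleMap 0 r θ)⁻¹) ^ p =
      2 * Real.pi * binomialProductCoeff s p := by
  have hne : ∀ θ, circleMap 0 r θ ≠ 0 := fun θ => circleMap_ne_center hr.ne'
  have hne1 : ∀ θ, 1 + circleMap 0 r θ ≠ 0 := fun θ => by
    refine Complex.slitPlane_ne_zero (Complex.mem_slitPlane_of_norm_lt_one ?_)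
    rw [norm_circleMap_zero, abs_of_pos hr]
    exact hr1
  have hcont : ∀ m : ℕ, Continuous fun θ : ℝ =>
      (1 + circleMap 0 r θ) ^ ((s + m : ℝ) : ℂ) * ((circleMap 0 r θ)⁻¹) ^ p := fun m =>
    (continuous_one_add_circleMap_cpow hr hr1 _).mul
      (((continuous_circleMap 0 r).inv₀ hne).pow p)
  have hexp : ∀ θ : ℝ, (1 + circleMap 0 r θ) ^ (s : ℂ) *
      (1 - circleMap 0 r θ) ^ (p + 1) * ((circleMap 0 r θ)⁻¹) ^ p =
      ∑ m ∈ range (p + 2), ((-1) ^ m * ((p + 1).choose m : ℂ) * 2 ^ (p + 1 - m)) *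
        ((1 + circleMap 0 r θ) ^ ((s + m : ℝ) : ℂ) * ((circleMap 0 r θ)⁻¹) ^ p) := fun θ => by
    rw [show 1 - circleMap 0 r θ = -(1 + circleMap 0 r θ) + 2 by ring, add_pow, mul_sum, sum_mul]
    refine sum_congr rfl fun m _ => ?_
    push_cast
    rw [Complex.cpow_add _ _ (hne1 θ), Complex.cpow_natCast, neg_pow]
    ring
  simp_rw [hexp]
  rw [intervalIntegral.integral_finsetSum fun m _ =>
    ((hcont m).const_mul _).intervalIntegrable _ _, binomialProductCoeff, Complex.ofReal_sum,
    mul_sum]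
  refine sum_congr rfl fun m _ => ?_
  rw [intervalIntegral.integral_const_mul, integral_one_add_circleMap_cpow hr hr1,
    ← Complex.ofReal_choose]
  push_cast
  ring

end ContourIntegral

section LaplaceMethod

open Finset MeasureTheory

/-! ### Laplace's method with a complex phase -/

/-- For `‖u - v‖ ≤ 1` this is Taylor's bound; otherwise the triangle inequality and `2 + x ≤ 3 x ^
2` suffice. With no smallness required, the whole range of angles can be treated at once. -/
lemma norm_exp_sub_exp_sub_mul_le {u v : ℂ} {M : ℝ} (hu : u.re ≤ M) (hv : v.re ≤ M) :
    ‖Complex.exp u - Complex.exp v - (u - v) * Complex.exp v‖ ≤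
      3 * ‖u - v‖ ^ 2 * Real.exp M := by
  have hev : ‖Complex.exp v‖ ≤ Real.exp M := by
    rw [Complex.norm_exp]; exact Real.exp_le_exp.2 hv
  have heu : ‖Complex.exp u‖ ≤ Real.exp M := by
    rw [Complex.norm_exp]; exact Real.exp_le_exp.2 hu
  have hM := (Real.exp_pos M).le
  rcases le_or_gt ‖u - v‖ 1 with h | h
  · have e : Complex.exp u - Complex.exp v - (u - v) * Complex.exp v =
        (Complex.exp (u - v) - 1 - (u - v)) * Complex.exp v := by
      rw [Complex.exp_sub]
      have := Complex.exp_ne_zero v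
      field_simp
    rw [e, norm_mul]
    have h1 := Complex.norm_exp_sub_one_sub_id_le h
    calc _ ≤ ‖u - v‖ ^ 2 * Real.exp M := by gcongr
      _ ≤ 3 * ‖u - v‖ ^ 2 * Real.exp M := by gcongr; linarith [sq_nonneg ‖u - v‖]
  · calc _ ≤ ‖Complex.exp u‖ + ‖Complex.exp v‖ + ‖u - v‖ * ‖Complex.exp v‖ := by
          rw [← norm_mul]
          exact (norm_sub_le _ _).trans (add_le_add_left (norm_sub_le _ _) _)
      _ ≤ Real.exp M + Real.exp M + ‖u - v‖ * Real.exp M := by gcongr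
      _ = (2 + ‖u - v‖) * Real.exp M := by ring
      _ ≤ 3 * ‖u - v‖ ^ 2 * Real.exp M := by
          gcongr
          nlinarith

/-- Used with `x = N θ ^ 2`, to absorb powers into half of the Gaussian decay. -/
lemma exists_poly_le_exp {c : ℝ} (hc : 0 < c) :
    ∃ K : ℝ, 0 ≤ K ∧ ∀ x : ℝ, 0 ≤ x → x + x ^ 2 + x ^ 3 ≤ K * Real.exp (c * x) := by
  refine ⟨1 / c + 2 / c ^ 2 + 6 / c ^ 3, by positivity, fun x hx => ?_⟩
  have h1 := Real.pow_div_factorial_le_exp (c * x) (by positivity) 1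
  have h2 := Real.pow_div_factorial_le_exp (c * x) (by positivity) 2
  have h3 := Real.pow_div_factorial_le_exp (c * x) (by positivity) 3
  norm_num [Nat.factorial] at h1 h2 h3
  have e : x + x ^ 2 + x ^ 3 = 1 / c * (c * x) + 2 / c ^ 2 * ((c * x) ^ 2 / 2) +
      6 / c ^ 3 * ((c * x) ^ 3 / 6) := by field_simp
  rw [e, add_mul, add_mul]
  gcongr

lemma abs_integral_gaussian_sub_le {b : ℝ} (hb : 0 < b) :
    |(∫ θ in (-Real.pi)..Real.pi, Real.exp (-b * θ ^ 2)) - Real.sqrt (Real.pi / b)| ≤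
      2 / (b * Real.pi ^ 2) * Real.sqrt (Real.pi / (b / 2)) := by
  have hπ := Real.pi_pos
  have hb2 : 0 < b / 2 := by positivity
  have hint := integrable_exp_neg_mul_sq hb
  have hint2 := integrable_exp_neg_mul_sq hb2
  rw [← integral_gaussian b, ← integral_gaussian (b / 2),
    intervalIntegral.integral_of_le (by linarith),
    ← integral_add_compl (measurableSet_Ioc (a := -Real.pi) (b := Real.pi)) hint,
    sub_add_cancel_left, abs_neg, abs_of_nonneg (integral_nonneg fun _ => (Real.exp_pos _).le),
    ← integral_const_mul]
  -- On the tail, half of the exponent is traded for the factor `2 / (b π ^ 2)` through `y ≤ exp y`;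
  -- a gain of `1 / b` is all that is needed.
  calc _ ≤ ∫ x in (Set.Ioc (-Real.pi) Real.pi)ᶜ,
        2 / (b * Real.pi ^ 2) * Real.exp (-(b / 2) * x ^ 2) := by
        refine setIntegral_mono_on hint.integrableOn (hint2.const_mul _).integrableOn
          measurableSet_Ioc.compl fun x hx => ?_
        have hx2 : Real.pi ^ 2 ≤ x ^ 2 := by
          rw [sq_le_sq, abs_of_pos hπ]
          by_contra h
          exact hx ⟨(abs_lt.1 (not_le.1 h)).1, (abs_lt.1 (not_le.1 h)).2.le⟩
        have e : Real.exp (-b * x ^ 2) =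
            Real.exp (-(b / 2 * x ^ 2)) * Real.exp (-(b / 2) * x ^ 2) := by
          rw [← Real.exp_add]; ring_nf
        rw [e]
        gcongr
        rw [Real.exp_neg]
        have h1 : b * Real.pi ^ 2 / 2 ≤ Real.exp (b / 2 * x ^ 2) := by
          have := Real.add_one_le_exp (b / 2 * x ^ 2)
          nlinarith
        rw [inv_le_comm₀ (Real.exp_pos _) (by positivity), inv_div]
        exact h1
    _ ≤ _ := setIntegral_le_integral (hint2.const_mul _)
        (Filter.Eventually.of_forall fun x => by positivity)

lemma intervalIntegral_eq_zero_of_odd {f : ℝ → ℂ} (hf : ∀ x, f (-x) = -f x) (b : ℝ) :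
    ∫ x in (-b)..b, f x = 0 := by
  have h := intervalIntegral.integral_comp_neg (a := -b) (b := b) f
  simp only [hf, neg_neg, intervalIntegral.integral_neg] at h
  exact self_eq_neg.1 h.symm

/-- **Laplace's method** on `[-π, π]` for a complex phase `Φ` with a quadratic critical point at
zero, with relative error `O(1 / N)`. -/
theorem exists_norm_integral_exp_mul_sub_le {a c C : ℝ} {c₃ g₁ : ℂ} {Φ g : ℝ → ℂ} (hc : 0 < c)
    (hca : c ≤ a / 2) (hC : 0 ≤ C) (hΦc : Continuous Φ) (hgc : Continuous g)
    (hΦ : ∀ θ, |θ| ≤ Real.pi → ‖Φ θ + a / 2 * θ ^ 2 - c₃ * θ ^ 3‖ ≤ C * |θ| ^ 4)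
    (hg : ∀ θ, |θ| ≤ Real.pi → ‖g θ - 1 - g₁ * θ‖ ≤ C * |θ| ^ 2)
    (hre : ∀ θ, |θ| ≤ Real.pi → (Φ θ).re ≤ -c * θ ^ 2) :
    ∃ K : ℝ, 0 ≤ K ∧ ∀ N : ℝ, 0 < N →
      ‖(∫ θ in (-Real.pi)..Real.pi, Complex.exp (N * Φ θ) * g θ) -
        (Real.sqrt (2 * Real.pi / (a * N)) : ℝ)‖ ≤ K / N * Real.sqrt (2 * Real.pi / (a * N)) := by
  have hπ := Real.pi_pos
  have ha : 0 < a := by linarith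
  set D := ‖g₁‖ + C * Real.pi with hD
  set E := ‖c₃‖ + C * Real.pi with hE
  set G := 1 + D * Real.pi with hG
  have hD0 : 0 ≤ D := by positivity
  have hE0 : 0 ≤ E := by positivity
  have hG0 : 0 ≤ G := by positivity
  obtain ⟨K₀, hK₀, hpoly⟩ := exists_poly_le_exp (show 0 < c / 2 by positivity)
  set K₁ := 3 * E ^ 2 * G + C + E * D + C with hK₁
  have hK₁0 : 0 ≤ K₁ := by positivity
  -- the pointwise estimate
  have hpt : ∀ N : ℝ, 0 < N → ∀ θ, |θ| ≤ Real.pi →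
      ‖Complex.exp (N * Φ θ) * g θ -
        Complex.exp (-(N * a / 2) * θ ^ 2) * (1 + (g₁ * θ + N * c₃ * θ ^ 3))‖ ≤
        K₁ * K₀ / N * Real.exp (-(N * c / 2) * θ ^ 2) := by
    intro N hN θ hθ
    set x := |θ| with hx
    have hx0 : 0 ≤ x := abs_nonneg θ
    have hx2 : θ ^ 2 = x ^ 2 := (sq_abs θ).symm
    set R := Φ θ + a / 2 * θ ^ 2 - c₃ * θ ^ 3 with hR
    have hRb : ‖R‖ ≤ C * x ^ 4 := hΦ θ hθ
    have hnθ : ‖(θ : ℂ)‖ = x := by simp [hx]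
    have hg1 : ‖g θ - 1‖ ≤ D * x := by
      have : g θ - 1 = (g θ - 1 - g₁ * θ) + g₁ * θ := by ring
      rw [this]
      refine (norm_add_le _ _).trans ?_
      rw [norm_mul, hnθ]
      have := hg θ hθ
      have : C * x ^ 2 ≤ C * Real.pi * x := by
        rw [pow_two, ← mul_assoc]; gcongr
      rw [hD]
      linarith [hg θ hθ]
    have hgn : ‖g θ‖ ≤ G := by
      have : g θ = (g θ - 1) + 1 := by ring
      rw [this]
      refine (norm_add_le _ _).trans ?_
      have : D * x ≤ D * Real.pi := by gcongr
      simp only [norm_one]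
      linarith
    set u : ℂ := N * Φ θ with hu
    set v : ℂ := -(N * a / 2) * θ ^ 2 with hv
    have huv : u - v = N * (c₃ * θ ^ 3 + R) := by rw [hu, hv, hR]; ring
    have huvn : ‖u - v‖ ≤ N * (E * x ^ 3) := by
      rw [huv, norm_mul, Complex.norm_real, Real.norm_of_nonneg hN.le]
      gcongr
      refine (norm_add_le _ _).trans ?_
      rw [norm_mul, norm_pow, hnθ, hE, add_mul]
      have : C * x ^ 4 ≤ C * Real.pi * x ^ 3 := by
        rw [pow_succ, mul_comm (x ^ 3) x, ← mul_assoc]; gcongr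
      linarith
    have hure : u.re ≤ -(N * c) * x ^ 2 := by
      rw [hu, Complex.re_ofReal_mul, ← hx2]
      have := mul_le_mul_of_nonneg_left (hre θ hθ) hN.le
      linarith
    have hvre' : v = ((-(N * a / 2) * θ ^ 2 : ℝ) : ℂ) := by rw [hv]; push_cast; ring
    have hvre : v.re ≤ -(N * c) * x ^ 2 := by
      rw [hvre', Complex.ofReal_re, hx2]
      have : N * c * x ^ 2 ≤ N * (a / 2) * x ^ 2 := by gcongr
      linarith
    have hev : ‖Complex.exp v‖ ≤ Real.exp (-(N * c) * x ^ 2) := by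
      rw [Complex.norm_exp]; exact Real.exp_le_exp.2 hvre
    have hmain := norm_exp_sub_exp_sub_mul_le hure hvre
    -- The first term is quadratic in `u - v`; the bracket collects what remains of `(1 + (u - v)) *
    -- g` after removing the constant and the two odd terms. Every piece is `1 / N` times a power of
    -- `N θ ^ 2`.
    have hsplit : Complex.exp u * g θ - Complex.exp v * (1 + (g₁ * θ + N * c₃ * θ ^ 3)) =
        (Complex.exp u - Complex.exp v - (u - v) * Complex.exp v) * g θ +
        Complex.exp v * ((g θ - 1 - g₁ * θ) + (u - v) * (g θ - 1) + N * R) := by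
      linear_combination (-Complex.exp v) * huv
    rw [hsplit]
    have hb1 : ‖(Complex.exp u - Complex.exp v - (u - v) * Complex.exp v) * g θ‖ ≤
        3 * (N * (E * x ^ 3)) ^ 2 * Real.exp (-(N * c) * x ^ 2) * G := by
      rw [norm_mul]
      refine mul_le_mul (hmain.trans ?_) hgn (norm_nonneg _) (by positivity)
      gcongr
    have hb2 : ‖Complex.exp v * ((g θ - 1 - g₁ * θ) + (u - v) * (g θ - 1) + N * R)‖ ≤
        Real.exp (-(N * c) * x ^ 2) *
          (C * x ^ 2 + N * (E * x ^ 3) * (D * x) + N * (C * x ^ 4)) := by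
      rw [norm_mul]
      refine mul_le_mul hev ?_ (norm_nonneg _) (Real.exp_pos _).le
      refine (norm_add_le _ _).trans (add_le_add ((norm_add_le _ _).trans
        (add_le_add (hg θ hθ) ?_)) ?_)
      · rw [norm_mul]; gcongr
      · rw [norm_mul, Complex.norm_real, Real.norm_of_nonneg hN.le]; gcongr
    have hp := hpoly (N * x ^ 2) (by positivity)
    have he : Real.exp (-(N * c / 2) * θ ^ 2) =
        Real.exp (-(N * c) * x ^ 2) * Real.exp (c / 2 * (N * x ^ 2)) := by
      rw [← Real.exp_add, hx2]; ring_nf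
    rw [he]
    have hX := (Real.exp_pos (-(N * c) * x ^ 2)).le
    set X := Real.exp (-(N * c) * x ^ 2)
    calc _ ≤ 3 * (N * (E * x ^ 3)) ^ 2 * X * G +
          X * (C * x ^ 2 + N * (E * x ^ 3) * (D * x) + N * (C * x ^ 4)) :=
          (norm_add_le _ _).trans (add_le_add hb1 hb2)
      _ = X / N * (3 * E ^ 2 * G * (N * x ^ 2) ^ 3 + C * (N * x ^ 2) +
          (E * D + C) * (N * x ^ 2) ^ 2) := by field_simp; ring
      _ ≤ X / N * (K₁ * (N * x ^ 2) ^ 3 + K₁ * (N * x ^ 2) + K₁ * (N * x ^ 2) ^ 2) := by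
          have h1 : 0 ≤ 3 * E ^ 2 * G := by positivity
          have h2 : 0 ≤ E * D := by positivity
          gcongr <;> linarith
      _ = X / N * K₁ * (N * x ^ 2 + (N * x ^ 2) ^ 2 + (N * x ^ 2) ^ 3) := by ring
      _ ≤ X / N * K₁ * (K₀ * Real.exp (c / 2 * (N * x ^ 2))) := by gcongr
      _ = _ := by ring
  refine ⟨K₁ * K₀ * Real.sqrt (2 * a / c) + 4 / (a * Real.pi ^ 2) * Real.sqrt 2, by positivity,
    fun N hN => ?_⟩
  set S := Real.sqrt (2 * Real.pi / (a * N)) with hS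
  have hb : 0 < N * a / 2 := by positivity
  -- These corrections would be of relative size `N ^ (-1/2)`; being odd, they integrate to zero.
  have hodd : ∫ θ in (-Real.pi)..Real.pi, Complex.exp (-(N * a / 2) * (θ : ℂ) ^ 2) *
      (g₁ * θ + N * c₃ * θ ^ 3) = 0 := by
    refine intervalIntegral_eq_zero_of_odd (fun θ => ?_) _
    push_cast
    ring_nf
  have hgauss : ∫ θ in (-Real.pi)..Real.pi, Complex.exp (-(N * a / 2) * (θ : ℂ) ^ 2) =
      ((∫ θ in (-Real.pi)..Real.pi, Real.exp (-(N * a / 2) * θ ^ 2) : ℝ) : ℂ) := by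
    rw [← intervalIntegral.integral_ofReal]
    refine intervalIntegral.integral_congr fun θ _ => ?_
    push_cast
    ring_nf
  have hi1 : IntervalIntegrable (fun θ => Complex.exp (N * Φ θ) * g θ) volume
      (-Real.pi) Real.pi := Continuous.intervalIntegrable (by fun_prop) _ _
  have hi2 : IntervalIntegrable (fun θ : ℝ => Complex.exp (-(N * a / 2) * (θ : ℂ) ^ 2))
      volume (-Real.pi) Real.pi := Continuous.intervalIntegrable (by fun_prop) _ _
  have hi3 : IntervalIntegrable (fun θ : ℝ => Complex.exp (-(N * a / 2) * (θ : ℂ) ^ 2) *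
      (g₁ * θ + N * c₃ * θ ^ 3)) volume (-Real.pi) Real.pi :=
    Continuous.intervalIntegrable (by fun_prop) _ _
  have hcomb : (∫ θ in (-Real.pi)..Real.pi, Complex.exp (N * Φ θ) * g θ) -
      ((∫ θ in (-Real.pi)..Real.pi, Real.exp (-(N * a / 2) * θ ^ 2) : ℝ) : ℂ) =
      ∫ θ in (-Real.pi)..Real.pi, (Complex.exp (N * Φ θ) * g θ -
        Complex.exp (-(N * a / 2) * θ ^ 2) * (1 + (g₁ * θ + N * c₃ * θ ^ 3))) := by
    simp only [mul_add _ (1 : ℂ), mul_one]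
    rw [intervalIntegral.integral_sub hi1 (hi2.add hi3), intervalIntegral.integral_add hi2 hi3,
      hgauss, hodd, add_zero]
  have hbc : 0 < N * c / 2 := by positivity
  have h1 : ‖(∫ θ in (-Real.pi)..Real.pi, Complex.exp (N * Φ θ) * g θ) -
      ((∫ θ in (-Real.pi)..Real.pi, Real.exp (-(N * a / 2) * θ ^ 2) : ℝ) : ℂ)‖ ≤
      K₁ * K₀ / N * Real.sqrt (Real.pi / (N * c / 2)) := by
    rw [hcomb, ← integral_gaussian, ← integral_const_mul]
    have hint := (integrable_exp_neg_mul_sq hbc).const_mul (K₁ * K₀ / N)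
    refine (intervalIntegral.norm_integral_le_of_norm_le (by linarith)
      (g := fun θ => K₁ * K₀ / N * Real.exp (-(N * c / 2) * θ ^ 2))
      (Filter.Eventually.of_forall fun θ hθ => hpt N hN θ (abs_le.2 ⟨hθ.1.le, hθ.2⟩))
      hint.intervalIntegrable).trans ?_
    rw [intervalIntegral.integral_of_le (by linarith)]
    exact setIntegral_le_integral hint (Filter.Eventually.of_forall fun x => by positivity)
  have h2 := abs_integral_gaussian_sub_le hb
  have e1 : Real.sqrt (Real.pi / (N * c / 2)) = Real.sqrt (2 * a / c) * S / Real.sqrt 2 := by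
    rw [hS, ← Real.sqrt_mul (by positivity), ← Real.sqrt_div (by positivity)]
    congr 1
    field_simp
  have e2 : Real.sqrt (Real.pi / (N * a / 2)) = S := by
    rw [hS]; congr 1; field_simp
  have e3 : Real.sqrt (Real.pi / (N * a / 2 / 2)) = Real.sqrt 2 * S := by
    rw [hS, ← Real.sqrt_mul (by norm_num)]; congr 1; field_simp
  rw [e1] at h1
  rw [e2, e3] at h2
  have hS0 : 0 ≤ S := Real.sqrt_nonneg _
  have hs2 : 1 ≤ Real.sqrt 2 := Real.one_le_sqrt.2 (by norm_num)
  have h3 : Real.sqrt (2 * a / c) * S / Real.sqrt 2 ≤ Real.sqrt (2 * a / c) * S :=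
    div_le_self (by positivity) hs2
  have h4 : K₁ * K₀ / N * (Real.sqrt (2 * a / c) * S / Real.sqrt 2) ≤
      K₁ * K₀ / N * (Real.sqrt (2 * a / c) * S) := by gcongr
  have h2' : ‖((∫ θ in (-Real.pi)..Real.pi, Real.exp (-(N * a / 2) * θ ^ 2) : ℝ) : ℂ) -
      (S : ℂ)‖ ≤ 2 / (N * a / 2 * Real.pi ^ 2) * (Real.sqrt 2 * S) := by
    rw [← Complex.ofReal_sub, Complex.norm_real]
    exact h2
  calc _ ≤ _ := norm_sub_le_norm_sub_add_norm_sub _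
        ((∫ θ in (-Real.pi)..Real.pi, Real.exp (-(N * a / 2) * θ ^ 2) : ℝ) : ℂ) _
    _ ≤ K₁ * K₀ / N * (Real.sqrt (2 * a / c) * S) +
        2 / (N * a / 2 * Real.pi ^ 2) * (Real.sqrt 2 * S) := add_le_add (h1.trans h4) h2'
    _ = _ := by field_simp; ring

end LaplaceMethod

section PhaseEstimates

open Finset MeasureTheory

/-! ### Taylor bounds from bounds on derivatives -/

/-- The mean value inequality on the ball of radius `|x|`. The gain `1 / (n + 1)` is given up so
that iteration keeps the same `C`. -/
lemma norm_le_of_norm_deriv_le_pow {F F' : ℝ → ℂ} {B C : ℝ} {n : ℕ} (hC : 0 ≤ C)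
    (hF : ∀ x, HasDerivAt F (F' x) x) (h0 : F 0 = 0)
    (hb : ∀ x, |x| ≤ B → ‖F' x‖ ≤ C * |x| ^ n) {x : ℝ} (hx : |x| ≤ B) :
    ‖F x‖ ≤ C * |x| ^ (n + 1) := by
  have hmem : ∀ y ∈ Metric.closedBall (0 : ℝ) |x|, |y| ≤ |x| := fun y hy => by simpa using hy
  have h := Convex.norm_image_sub_le_of_norm_hasDerivWithin_le (f := F) (f' := F')
    (s := Metric.closedBall (0 : ℝ) |x|) (C := C * |x| ^ n) (x := 0) (y := x)
    (fun y _ => (hF y).hasDerivWithinAt)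
    (fun y hy => (hb y ((hmem y hy).trans hx)).trans
      (mul_le_mul_of_nonneg_left (pow_le_pow_left₀ (abs_nonneg _) (hmem y hy) _) hC))
    (convex_closedBall _ _) (by simp) (by simp)
  rw [h0, sub_zero, sub_zero, Real.norm_eq_abs] at h
  rw [pow_succ, ← mul_assoc]
  exact h

lemma exists_norm_sub_sub_mul_le {f : ℝ → ℂ} (hf : ContDiff ℝ 2 f) (B : ℝ) :
    ∃ C : ℝ, 0 ≤ C ∧ ∀ x, |x| ≤ B → ‖f x - f 0 - deriv f 0 * x‖ ≤ C * |x| ^ 2 := by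
  have hf' : ContDiff ℝ 1 (deriv f) := ((contDiff_succ_iff_deriv (n := 1)).1 hf).2.2
  have hf'' : Continuous (deriv (deriv f)) :=
    ((contDiff_succ_iff_deriv (n := 0)).1 hf').2.2.continuous
  obtain ⟨C, hC⟩ := (isCompact_closedBall (0 : ℝ) B).exists_bound_of_continuousOn hf''.continuousOn
  have hC' : ∀ x, |x| ≤ B → ‖deriv (deriv f) x‖ ≤ max C 0 * |x| ^ 0 := fun x hx => by
    rw [pow_zero, mul_one]
    exact (hC x (by simpa using hx)).trans (le_max_left _ _)
  have hd : ∀ x, HasDerivAt f (deriv f x) x := fun x =>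
    (hf.differentiable (by norm_num) x).hasDerivAt
  have hd' : ∀ x, HasDerivAt (deriv f) (deriv (deriv f) x) x := fun x =>
    (hf'.differentiable (by norm_num) x).hasDerivAt
  refine ⟨max C 0, le_max_right _ _, fun x hx => ?_⟩
  refine norm_le_of_norm_deriv_le_pow (F := fun x => f x - f 0 - deriv f 0 * x)
    (F' := fun x => deriv f x - deriv f 0) (le_max_right _ _) (fun y => ?_) (by simp)
    (fun y hy => ?_) hx
  · have h1 : HasDerivAt (fun x : ℝ => deriv f 0 * (x : ℂ)) (deriv f 0) y := by
      simpa using (Complex.ofRealCLM.hasDerivAt (x := y)).const_mul (deriv f 0)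
    exact ((hd y).sub_const _).sub h1
  · exact norm_le_of_norm_deriv_le_pow (F := fun x => deriv f x - deriv f 0)
      (le_max_right _ _) (fun z => (hd' z).sub_const _) (by simp) hC' hy

/-! ### The phase and the amplitude -/

/-- The phase of the integral over the circle of radius `r`. -/
noncomputable def saddlePhase (ε r θ : ℝ) : ℂ :=
  (1 + ε) * (Complex.log (1 + circleMap 0 r θ) - Real.log (1 + r)) +
    (1 - ε) * (Complex.log (1 - circleMap 0 r θ) - Real.log (1 - r)) -
    (1 - ε) * (θ * Complex.I)

/-- The amplitude of the integral over the circle of radius `r`. -/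
noncomputable def saddleAmplitude (s r θ : ℝ) : ℂ :=
  Complex.exp (s * (Complex.log (1 + circleMap 0 r θ) - Real.log (1 + r)) + θ * Complex.I)

section Saddle

variable {ε r : ℝ}

lemma one_add_circleMap_mem_slitPlane (hr : 0 < r) (hr1 : r < 1) (θ : ℝ) :
    1 + circleMap 0 r θ ∈ Complex.slitPlane := by
  refine Complex.mem_slitPlane_of_norm_lt_one ?_
  rw [norm_circleMap_zero, abs_of_pos hr]
  exact hr1

lemma one_sub_circleMap_mem_slitPlane (hr : 0 < r) (hr1 : r < 1) (θ : ℝ) :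
    1 - circleMap 0 r θ ∈ Complex.slitPlane := by
  rw [sub_eq_add_neg]
  refine Complex.mem_slitPlane_of_norm_lt_one ?_
  rw [norm_neg, norm_circleMap_zero, abs_of_pos hr]
  exact hr1

lemma circleMap_zero_apply_zero (r : ℝ) : circleMap 0 r 0 = r := by simp [circleMap]

lemma ofReal_log_one_add (hr : 0 < r) : Complex.log (1 + r) = Real.log (1 + r) := by
  rw [Complex.ofReal_log (by linarith)]; push_cast; rfl

lemma ofReal_log_one_sub (hr1 : r < 1) : Complex.log (1 - r) = Real.log (1 - r) := by
  rw [Complex.ofReal_log (by linarith)]; push_cast; rfl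

lemma contDiff_saddleAmplitude (s : ℝ) (hr : 0 < r) (hr1 : r < 1) :
    ContDiff ℝ 2 (saddleAmplitude s r) := by
  have h1 : ContDiff ℝ 2 fun θ : ℝ => Complex.log (1 + circleMap 0 r θ) := by
    rw [contDiff_iff_contDiffAt]
    intro θ
    exact ((Complex.contDiffAt_log (one_add_circleMap_mem_slitPlane hr hr1 θ)).restrict_scalars
      ℝ).comp θ (contDiff_const.add (contDiff_circleMap 0 r)).contDiffAt
  have h2 : ContDiff ℝ 2 fun θ : ℝ => (θ : ℂ) := Complex.ofRealCLM.contDiff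
  unfold saddleAmplitude
  exact Complex.contDiff_exp.comp
    ((contDiff_const.mul (h1.sub contDiff_const)).add (h2.mul contDiff_const))

lemma saddleAmplitude_zero (s : ℝ) (hr : 0 < r) : saddleAmplitude s r 0 = 1 := by
  simp [saddleAmplitude, circleMap_zero_apply_zero, ofReal_log_one_add hr]

lemma saddlePhase_zero (hr : 0 < r) (hr1 : r < 1) : saddlePhase ε r 0 = 0 := by
  simp [saddlePhase, circleMap_zero_apply_zero, ofReal_log_one_add hr, ofReal_log_one_sub hr1]

lemma hasDerivAt_saddlePhase (hr : 0 < r) (hr1 : r < 1) (θ : ℝ) :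
    HasDerivAt (saddlePhase ε r)
      (Complex.I * ((1 + ε) * (circleMap 0 r θ / (1 + circleMap 0 r θ)) -
        (1 - ε) * (circleMap 0 r θ / (1 - circleMap 0 r θ)) - (1 - ε))) θ := by
  have hz := hasDerivAt_circleMap 0 r θ
  have h1 := ((hz.const_add 1).clog_real (one_add_circleMap_mem_slitPlane hr hr1 θ)).sub_const
    (Real.log (1 + r) : ℂ)
  have h2 := ((hz.const_sub 1).clog_real (one_sub_circleMap_mem_slitPlane hr hr1 θ)).sub_const
    (Real.log (1 - r) : ℂ)
  have h3 := (Complex.ofRealCLM.hasDerivAt (x := θ)).mul_const Complex.I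
  have h := ((h1.const_mul (1 + ε : ℂ)).add (h2.const_mul (1 - ε : ℂ))).sub
    (h3.const_mul (1 - ε : ℂ))
  refine h.congr_deriv ?_
  simp
  ring

lemma hasDerivAt_deriv_saddlePhase (hr : 0 < r) (hr1 : r < 1) (θ : ℝ) :
    HasDerivAt (fun θ : ℝ => Complex.I * ((1 + ε) * (circleMap 0 r θ / (1 + circleMap 0 r θ)) -
        (1 - ε) * (circleMap 0 r θ / (1 - circleMap 0 r θ)) - (1 - ε)))
      (-((1 + ε) * (circleMap 0 r θ / (1 + circleMap 0 r θ) ^ 2) -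
        (1 - ε) * (circleMap 0 r θ / (1 - circleMap 0 r θ) ^ 2))) θ := by
  have hz := hasDerivAt_circleMap 0 r θ
  have hp := Complex.slitPlane_ne_zero (one_add_circleMap_mem_slitPlane hr hr1 θ)
  have hm := Complex.slitPlane_ne_zero (one_sub_circleMap_mem_slitPlane hr hr1 θ)
  have h1 := hz.div (hz.const_add 1) hp
  have h2 := hz.div (hz.const_sub 1) hm
  have h := ((((h1.const_mul (1 + ε : ℂ)).sub (h2.const_mul (1 - ε : ℂ))).sub_const
    (1 - ε : ℂ)).const_mul Complex.I)
  refine h.congr_deriv ?_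
  have e1 : (circleMap 0 r θ * Complex.I * (1 + circleMap 0 r θ) -
      circleMap 0 r θ * (circleMap 0 r θ * Complex.I)) = Complex.I * circleMap 0 r θ := by ring
  have e2 : (circleMap 0 r θ * Complex.I * (1 - circleMap 0 r θ) -
      circleMap 0 r θ * -(circleMap 0 r θ * Complex.I)) = Complex.I * circleMap 0 r θ := by ring
  rw [e1, e2]
  linear_combination ((1 + ε) * (circleMap 0 r θ / (1 + circleMap 0 r θ) ^ 2) -
        (1 - ε) * (circleMap 0 r θ / (1 - circleMap 0 r θ) ^ 2)) * Complex.I_sq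

/-- Apply `log y ≤ y - 1` to the squared moduli `|1 ± z| ^ 2`, which are affine in `cos θ`. The
resulting slope is exactly the curvature at `θ = 0`, so the local maximum is seen to be global on
the circle. -/
lemma re_saddlePhase_le (hε0 : 0 < ε) (hε1 : ε < 1) (hr : 0 < r) (hr1 : r < 1) (θ : ℝ) :
    (saddlePhase ε r θ).re ≤
      -(r * ((1 + ε) / (1 + r) ^ 2 - (1 - ε) / (1 - r) ^ 2)) * (1 - Real.cos θ) := by
  have hlog : ∀ (w : ℂ) (ρ : ℝ), w ≠ 0 → 0 < ρ →
      Real.log ‖w‖ - Real.log ρ ≤ (‖w‖ ^ 2 / ρ ^ 2 - 1) / 2 := fun w ρ hw hρ => by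
    have hw' := norm_pos_iff.2 hw
    have h := Real.log_le_sub_one_of_pos (show 0 < (‖w‖ / ρ) ^ 2 by positivity)
    rw [Real.log_pow, Real.log_div hw'.ne' hρ.ne', div_pow] at h
    push_cast at h
    linarith
  have hp := hlog _ (1 + r) (Complex.slitPlane_ne_zero (one_add_circleMap_mem_slitPlane hr hr1 θ))
    (by linarith)
  have hm := hlog _ (1 - r) (Complex.slitPlane_ne_zero (one_sub_circleMap_mem_slitPlane hr hr1 θ))
    (by linarith)
  have hcos : (circleMap 0 r θ).re = r * Real.cos θ := by
    simp [circleMap, Complex.exp_re]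
  have hsin : (circleMap 0 r θ).im = r * Real.sin θ := by
    simp [circleMap, Complex.exp_im]
  have np : ‖1 + circleMap 0 r θ‖ ^ 2 = (1 + r) ^ 2 - 2 * r * (1 - Real.cos θ) := by
    rw [Complex.sq_norm, Complex.normSq_apply]
    simp only [Complex.add_re, Complex.add_im, Complex.one_re, Complex.one_im, hcos, hsin]
    linear_combination r ^ 2 * Real.sin_sq_add_cos_sq θ
  have nm : ‖1 - circleMap 0 r θ‖ ^ 2 = (1 - r) ^ 2 + 2 * r * (1 - Real.cos θ) := by
    rw [Complex.sq_norm, Complex.normSq_apply]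
    simp only [Complex.sub_re, Complex.sub_im, Complex.one_re, Complex.one_im, hcos, hsin]
    linear_combination r ^ 2 * Real.sin_sq_add_cos_sq θ
  have hre : (saddlePhase ε r θ).re =
      (1 + ε) * (Real.log ‖1 + circleMap 0 r θ‖ - Real.log (1 + r)) +
      (1 - ε) * (Real.log ‖1 - circleMap 0 r θ‖ - Real.log (1 - r)) := by
    simp [saddlePhase, Complex.log_re]
  rw [np] at hp
  rw [nm] at hm
  rw [hre]
  have h1 := mul_le_mul_of_nonneg_left hp (show 0 ≤ 1 + ε by linarith)
  have h2 := mul_le_mul_of_nonneg_left hm (show 0 ≤ 1 - ε by linarith)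
  refine (add_le_add h1 h2).trans (le_of_eq ?_)
  have : 1 + r ≠ 0 := by linarith
  have : 1 - r ≠ 0 := by linarith
  field_simp
  ring

/-- Expand the second derivative to first order and integrate twice. The constants of integration
vanish: the phase is zero at `θ = 0`, and so is its derivative by the saddle equation. -/
lemma exists_norm_saddlePhase_add_sub_le (hr : 0 < r) (hr1 : r < 1)
    (hsaddle : (1 + ε) * (r / (1 + r)) - (1 - ε) * (r / (1 - r)) = 1 - ε) {a : ℝ}
    (ha : a = r * ((1 + ε) / (1 + r) ^ 2 - (1 - ε) / (1 - r) ^ 2)) (B : ℝ) :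
    ∃ C : ℝ, 0 ≤ C ∧ ∃ c₃ : ℂ, ∀ θ, |θ| ≤ B →
      ‖saddlePhase ε r θ + a / 2 * θ ^ 2 - c₃ * θ ^ 3‖ ≤ C * |θ| ^ 4 := by
  set Φ₂ : ℝ → ℂ := fun θ => -((1 + ε) * (circleMap 0 r θ / (1 + circleMap 0 r θ) ^ 2) -
        (1 - ε) * (circleMap 0 r θ / (1 - circleMap 0 r θ) ^ 2)) with hΦ₂
  have hp : ∀ θ, (1 + circleMap 0 r θ) ^ 2 ≠ 0 := fun θ =>
    pow_ne_zero 2 (Complex.slitPlane_ne_zero (one_add_circleMap_mem_slitPlane hr hr1 θ))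
  have hm : ∀ θ, (1 - circleMap 0 r θ) ^ 2 ≠ 0 := fun θ =>
    pow_ne_zero 2 (Complex.slitPlane_ne_zero (one_sub_circleMap_mem_slitPlane hr hr1 θ))
  have hz : ContDiff ℝ 2 (circleMap 0 r) := contDiff_circleMap 0 r
  have hcd : ContDiff ℝ 2 Φ₂ := by
    simp only [hΦ₂, div_eq_mul_inv]
    exact ((contDiff_const.mul (hz.mul (((contDiff_const.add hz).pow 2).inv hp))).sub
      (contDiff_const.mul (hz.mul (((contDiff_const.sub hz).pow 2).inv hm)))).neg
  have hΦ₂0 : Φ₂ 0 = -a := by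
    simp only [hΦ₂, circleMap_zero_apply_zero, ha]
    push_cast
    ring
  obtain ⟨C, hC, hb⟩ := exists_norm_sub_sub_mul_le hcd B
  have hid : ∀ x : ℝ, HasDerivAt (fun x : ℝ => (x : ℂ)) 1 x := fun x =>
    (Complex.ofRealCLM.hasDerivAt (x := x)).congr_deriv (by simp)
  refine ⟨C, hC, deriv Φ₂ 0 / 6, fun θ hθ => ?_⟩
  refine norm_le_of_norm_deriv_le_pow (n := 3) (B := B)
    (F := fun θ => saddlePhase ε r θ + a / 2 * θ ^ 2 - deriv Φ₂ 0 / 6 * θ ^ 3)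
    (F' := fun θ => Complex.I * ((1 + ε) * (circleMap 0 r θ / (1 + circleMap 0 r θ)) -
        (1 - ε) * (circleMap 0 r θ / (1 - circleMap 0 r θ)) - (1 - ε)) + a * θ -
        deriv Φ₂ 0 / 2 * θ ^ 2) hC (fun x => ?_) ?_ (fun x hx => ?_) hθ
  · refine (((hasDerivAt_saddlePhase hr hr1 x).add (((hid x).pow 2).const_mul (a / 2 : ℂ))).sub
      (((hid x).pow 3).const_mul (deriv Φ₂ 0 / 6))).congr_deriv ?_
    simp only [Nat.cast_ofNat]
    ring
  · simp [saddlePhase_zero hr hr1]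
  · refine norm_le_of_norm_deriv_le_pow (n := 2) (B := B)
      (F := fun θ => Complex.I * ((1 + ε) * (circleMap 0 r θ / (1 + circleMap 0 r θ)) -
        (1 - ε) * (circleMap 0 r θ / (1 - circleMap 0 r θ)) - (1 - ε)) + a * θ -
        deriv Φ₂ 0 / 2 * θ ^ 2)
      (F' := fun θ => Φ₂ θ - Φ₂ 0 - deriv Φ₂ 0 * θ) hC (fun x => ?_) ?_ hb hx
    · refine (((hasDerivAt_deriv_saddlePhase hr hr1 x).add ((hid x).const_mul (a : ℂ))).sub
        (((hid x).pow 2).const_mul (deriv Φ₂ 0 / 2))).congr_deriv ?_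
      rw [hΦ₂0]
      simp only [hΦ₂, Nat.cast_ofNat]
      ring
    · simp only [circleMap_zero_apply_zero]
      have : ((1 + ε) * (r / (1 + r)) - (1 - ε) * (r / (1 - r)) - (1 - ε) : ℂ) = 0 := by
        have := congrArg (fun x : ℝ => (x : ℂ) - (1 - ε)) hsaddle
        push_cast at this
        rw [this]; ring
      rw [this]
      simp

end Saddle

end PhaseEstimates

/-! ### Saddle-point value of the Taylor coefficient; Gamma ratios -/

section Ratios

open Finset MeasureTheory

section Saddle

variable {ε r : ℝ}

/-- With `j = ε i` and `p = (1 - ε) i - 1`, the parts of the exponents proportional to `i` form the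
phase; the leftover `2 lam - 1` and the extra factor `z` form the amplitude. -/
lemma cpow_mul_pow_mul_inv_pow_eq (hr : 0 < r) (hr1 : r < 1) (lam : ℝ) {i j p : ℕ}
    (hi : i = j + p + 1) (hj : (j : ℝ) = ε * i) (θ : ℝ) :
    (1 + circleMap 0 r θ) ^ ((i + j + 2 * lam - 1 : ℝ) : ℂ) * (1 - circleMap 0 r θ) ^ (p + 1) *
        ((circleMap 0 r θ)⁻¹) ^ p =
      (((1 + r) ^ (i + j + 2 * lam - 1) * (1 - r) ^ (p + 1) * (r⁻¹) ^ p : ℝ) : ℂ) *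
        (Complex.exp ((i : ℝ) * saddlePhase ε r θ) * saddleAmplitude (2 * lam - 1) r θ) := by
  have hp := Complex.slitPlane_ne_zero (one_add_circleMap_mem_slitPlane hr hr1 θ)
  have hm := Complex.slitPlane_ne_zero (one_sub_circleMap_mem_slitPlane hr hr1 θ)
  have hz : (circleMap 0 r θ)⁻¹ = (r : ℂ)⁻¹ * Complex.exp (-(θ * Complex.I)) := by
    rw [circleMap, zero_add, mul_inv, Complex.exp_neg]
  have e1 : (1 - circleMap 0 r θ) ^ (p + 1) =
      Complex.exp ((p + 1 : ℕ) * Complex.log (1 - circleMap 0 r θ)) := by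
    rw [Complex.exp_nat_mul, Complex.exp_log hm]
  have e2 : (((1 - r) ^ (p + 1) : ℝ) : ℂ) = Complex.exp ((p + 1 : ℕ) * Real.log (1 - r)) := by
    rw [Complex.exp_nat_mul, ← Complex.ofReal_exp, Real.exp_log (by linarith)]
    push_cast; rfl
  have e3 : (((1 + r) ^ (i + j + 2 * lam - 1) : ℝ) : ℂ) =
      Complex.exp (Real.log (1 + r) * (i + j + 2 * lam - 1 : ℝ)) := by
    rw [Real.rpow_def_of_pos (by linarith)]
    push_cast; rfl
  have hpi : (p : ℂ) = i - ε * i - 1 := by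
    have : (p : ℝ) = i - ε * i - 1 := by rw [← hj, hi]; push_cast; ring
    rw [← Complex.ofReal_natCast p, this]; push_cast; ring
  have hji : (j : ℂ) = ε * i := by
    rw [← Complex.ofReal_natCast j, hj]; push_cast; ring
  rw [Complex.ofReal_mul, Complex.ofReal_mul, e2, e3, e1, hz, mul_pow, ← Complex.exp_nat_mul _ p,
    Complex.cpow_def_of_ne_zero hp, saddleAmplitude]
  have hexp : Complex.exp (Complex.log (1 + circleMap 0 r θ) * (i + j + 2 * lam - 1 : ℝ)) *
      Complex.exp ((p + 1 : ℕ) * Complex.log (1 - circleMap 0 r θ)) *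
      Complex.exp (p * -(θ * Complex.I)) =
      Complex.exp (Real.log (1 + r) * (i + j + 2 * lam - 1 : ℝ)) *
      Complex.exp ((p + 1 : ℕ) * Real.log (1 - r)) *
      (Complex.exp ((i : ℝ) * saddlePhase ε r θ) *
        Complex.exp ((2 * lam - 1 : ℝ) * (Complex.log (1 + circleMap 0 r θ) - Real.log (1 + r)) +
          θ * Complex.I)) := by
    rw [← Complex.exp_add, ← Complex.exp_add, ← Complex.exp_add, ← Complex.exp_add,
      ← Complex.exp_add, saddlePhase]
    congr 1
    push_cast
    rw [hpi, hji]
    ring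
  push_cast at hexp ⊢
  linear_combination ((r : ℂ)⁻¹ ^ p) * hexp

/-- Asymptotics of `binomialProductCoeff` from the saddle point `r`. -/
theorem exists_abs_binomialProductCoeff_sub_le (lam : ℝ) (hε0 : 0 < ε) (hε1 : ε < 1) (hr : 0 < r)
    (hr1 : r < 1) (hsaddle : (1 + ε) * (r / (1 + r)) - (1 - ε) * (r / (1 - r)) = 1 - ε) {a : ℝ}
    (ha : a = r * ((1 + ε) / (1 + r) ^ 2 - (1 - ε) / (1 - r) ^ 2)) (ha0 : 0 < a) :
    ∃ K : ℝ, 0 ≤ K ∧ ∀ i j p : ℕ, i = j + p + 1 → (j : ℝ) = ε * i →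
      |binomialProductCoeff (i + j + 2 * lam - 1) p /
        ((1 + r) ^ (i + j + 2 * lam - 1) * (1 - r) ^ (p + 1) * (r⁻¹) ^ p *
          (Real.sqrt (2 * Real.pi / (a * i)) / (2 * Real.pi))) - 1| ≤ K / i := by
  have hπ := Real.pi_pos
  obtain ⟨C₁, hC₁, c₃, hΦ⟩ := exists_norm_saddlePhase_add_sub_le hr hr1 hsaddle ha Real.pi
  have hgd := contDiff_saddleAmplitude (2 * lam - 1) hr hr1
  obtain ⟨C₂, hC₂, hg⟩ := exists_norm_sub_sub_mul_le hgd Real.pi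
  rw [saddleAmplitude_zero _ hr] at hg
  have hΦc : Continuous (saddlePhase ε r) :=
    continuous_iff_continuousAt.2 fun θ => (hasDerivAt_saddlePhase hr hr1 θ).continuousAt
  have hπ2 : 2 / Real.pi ^ 2 ≤ 1 / 2 := by
    rw [div_le_div_iff₀ (by positivity) (by norm_num)]
    nlinarith [Real.pi_gt_three]
  -- The decay rate comes from `cos θ ≤ 1 - (2 / π ^ 2) θ ^ 2` on `[-π, π]`.
  obtain ⟨K, hK, hlap⟩ := exists_norm_integral_exp_mul_sub_le (a := a) (c := a * (2 / Real.pi ^ 2))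
    (C := max C₁ C₂) (c₃ := c₃) (g₁ := deriv (saddleAmplitude (2 * lam - 1) r) 0)
    (Φ := saddlePhase ε r) (g := saddleAmplitude (2 * lam - 1) r) (by positivity)
    (by nlinarith) (hC₁.trans (le_max_left _ _)) hΦc hgd.continuous
    (fun θ hθ => (hΦ θ hθ).trans (by gcongr; exact le_max_left _ _))
    (fun θ hθ => (hg θ hθ).trans (by gcongr; exact le_max_right _ _))
    (fun θ hθ => by
      refine (re_saddlePhase_le hε0 hε1 hr hr1 θ).trans ?_
      rw [← ha]
      have := Real.cos_le_one_sub_mul_cos_sq hθ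
      nlinarith)
  refine ⟨K, hK, fun i j p hi hj => ?_⟩
  have hi0 : (0 : ℝ) < i := by exact_mod_cast (by omega : 0 < i)
  set P := (1 + r) ^ (i + j + 2 * lam - 1) * (1 - r) ^ (p + 1) * (r⁻¹) ^ p with hP
  have hP0 : 0 < P := by
    have : 0 < 1 - r := by linarith
    positivity
  have hrep := integral_eq_binomialProductCoeff hr hr1 (i + j + 2 * lam - 1) p
  simp_rw [cpow_mul_pow_mul_inv_pow_eq hr hr1 lam hi hj] at hrep
  rw [intervalIntegral.integral_const_mul] at hrep
  set B := binomialProductCoeff (i + j + 2 * lam - 1) p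
  have hS : 0 < Real.sqrt (2 * Real.pi / (a * i)) := Real.sqrt_pos.2 (by positivity)
  have hl := hlap i hi0
  set S := Real.sqrt (2 * Real.pi / (a * i))
  set I := ∫ θ in (-Real.pi)..Real.pi, Complex.exp ((i : ℝ) * saddlePhase ε r θ) *
    saddleAmplitude (2 * lam - 1) r θ
  have hI : I = ((2 * Real.pi * B / P : ℝ) : ℂ) := by
    have : (P : ℂ) ≠ 0 := by exact_mod_cast hP0.ne'
    push_cast
    rw [eq_div_iff this, ← hrep, mul_comm]
  rw [hI, ← Complex.ofReal_sub, Complex.norm_real, Real.norm_eq_abs] at hl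
  have e : B / (P * (S / (2 * Real.pi))) - 1 = (2 * Real.pi * B / P - S) / S := by
    field_simp
  rw [e, abs_div, abs_of_pos hS, div_le_iff₀ hS]
  exact hl

end Saddle

/-! ### Functions of the form `1 + O(1 / N)` -/

open Asymptotics Filter Topology

/-- `f = 1 + O(1 / N)` along the filter `l`. -/
def IsOneAddBigOInv {α : Type*} (l : Filter α) (N f : α → ℝ) : Prop :=
  (fun x => f x - 1) =O[l] fun x => (N x)⁻¹

namespace IsOneAddBigOInv

variable {α : Type*} {l : Filter α} {N f g : α → ℝ}

lemma tendsto (hN : Tendsto N l atTop) (hf : IsOneAddBigOInv l N f) : Tendsto f l (𝓝 1) := by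
  have h := (IsBigO.trans_tendsto hf (tendsto_inv_atTop_zero.comp hN)).add_const 1
  simpa using h

lemma mul (hN : Tendsto N l atTop) (hf : IsOneAddBigOInv l N f) (hg : IsOneAddBigOInv l N g) :
    IsOneAddBigOInv l N fun x => f x * g x := by
  have h1 : (fun x => (f x - 1) * g x) =O[l] fun x => (N x)⁻¹ * 1 :=
    IsBigO.mul hf ((hg.tendsto hN).isBigO_one ℝ)
  simp only [mul_one] at h1
  exact (h1.add hg).congr_left fun x => by ring

lemma inv (hN : Tendsto N l atTop) (hf : IsOneAddBigOInv l N f) :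
    IsOneAddBigOInv l N fun x => (f x)⁻¹ := by
  have ht := hf.tendsto hN
  have h1 : (fun x => (f x - 1) * -(f x)⁻¹) =O[l] fun x => (N x)⁻¹ * 1 :=
    IsBigO.mul hf ((ht.inv₀ one_ne_zero).neg.isBigO_one ℝ)
  simp only [mul_one] at h1
  refine h1.congr' ?_ EventuallyEq.rfl
  filter_upwards [ht.eventually_ne one_ne_zero] with x hx
  field_simp
  ring

lemma sqrt (hf : IsOneAddBigOInv l N f) : IsOneAddBigOInv l N fun x => Real.sqrt (f x) := by
  refine IsBigO.trans (IsBigO.of_bound 1 (Eventually.of_forall fun x => ?_)) hf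
  simp only [one_mul, Real.norm_eq_abs]
  rcases le_total 0 (f x) with h | h
  · have hs := Real.sqrt_nonneg (f x)
    have e : f x - 1 = (Real.sqrt (f x) - 1) * (Real.sqrt (f x) + 1) := by
      nlinarith [Real.mul_self_sqrt h]
    rw [e, abs_mul]
    refine le_mul_of_one_le_right (abs_nonneg _) ?_
    rw [abs_of_pos (by linarith)]
    linarith
  -- For `f x ≤ 0` the root takes the value `0`, and `1 ≤ |f x - 1|` still holds.
  · rw [Real.sqrt_eq_zero_of_nonpos h, zero_sub, abs_neg, abs_one, abs_of_nonpos (by linarith)]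
    linarith

lemma one_add_div (c : ℝ) : IsOneAddBigOInv l N fun x => 1 + c / N x := by
  refine IsBigO.of_bound |c| (Eventually.of_forall fun x => ?_)
  rw [add_sub_cancel_left, div_eq_mul_inv, norm_mul, Real.norm_eq_abs c]

lemma congr' (hf : IsOneAddBigOInv l N f) (h : f =ᶠ[l] g) : IsOneAddBigOInv l N g :=
  IsBigO.congr' hf (h.mono fun x hx => by simp [hx]) EventuallyEq.rfl

end IsOneAddBigOInv

/-! ### Ratios of Gamma functions -/

/-- Log-convexity of Gamma, used between `n` and `n + 1` and between `n + s` and `n + s + 1`, traps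
the ratio between `1 - s / n` and `1`. -/
lemma isOneAddBigOInv_Gamma_of_mem_Ico {s : ℝ} (h0 : 0 ≤ s) (h1 : s < 1) :
    IsOneAddBigOInv atTop (fun n : ℕ => (n : ℝ))
      fun n : ℕ => Real.Gamma (n + s) / n.factorial / (n : ℝ) ^ (s - 1) := by
  refine IsBigO.of_bound s ((eventually_ge_atTop 1).mono fun n hn => ?_)
  have hn0 : (0 : ℝ) < n := by exact_mod_cast hn
  have hf : (n.factorial : ℝ) = n * Real.Gamma n := by
    rw [← Real.Gamma_add_one hn0.ne', Real.Gamma_nat_eq_factorial]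
  have hG := Real.Gamma_pos_of_pos hn0
  have hns : 0 < n + s := by linarith
  have hGs := Real.Gamma_pos_of_pos hns
  have hpow : (n : ℝ) * (n : ℝ) ^ (s - 1) = (n : ℝ) ^ s := by
    rw [Real.rpow_sub hn0, Real.rpow_one]; field_simp
  have hps : (0 : ℝ) < (n : ℝ) ^ s := by positivity
  have e : Real.Gamma (n + s) / n.factorial / (n : ℝ) ^ (s - 1) =
      Real.Gamma (n + s) / (Real.Gamma n * (n : ℝ) ^ s) := by
    rw [hf, ← hpow]; field_simp
  simp only
  rw [e, Real.norm_eq_abs, Real.norm_of_nonneg (by positivity)]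
  have hup : Real.Gamma (n + s) ≤ Real.Gamma n * (n : ℝ) ^ s := by
    rcases h0.eq_or_lt with rfl | h0
    · simp
    · have h := Real.Gamma_mul_add_mul_le_rpow_Gamma_mul_rpow_Gamma (s := n) (t := n + 1)
        (a := 1 - s) (b := s) hn0 (by positivity) (by linarith) h0 (by ring)
      rw [show (1 - s) * n + s * (n + 1) = n + s by ring, Real.Gamma_add_one hn0.ne',
        Real.mul_rpow hn0.le hG.le] at h
      have h2 : Real.Gamma n ^ (1 - s) * Real.Gamma n ^ s = Real.Gamma n := by
        rw [← Real.rpow_add hG]; simp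
      calc _ ≤ _ := h
        _ = Real.Gamma n ^ (1 - s) * Real.Gamma n ^ s * (n : ℝ) ^ s := by ring
        _ = _ := by rw [h2]
  have hlow : n * Real.Gamma n * (n : ℝ) ^ s ≤ Real.Gamma (n + s) * (n + s) := by
    rcases h0.eq_or_lt with rfl | h0
    · simp [mul_comm]
    · have h := Real.Gamma_mul_add_mul_le_rpow_Gamma_mul_rpow_Gamma (s := n + s) (t := n + s + 1)
        (a := s) (b := 1 - s) hns (by positivity) h0 (by linarith) (by ring)
      rw [show s * (n + s) + (1 - s) * (n + s + 1) = n + 1 by ring, Real.Gamma_add_one hn0.ne',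
        Real.Gamma_add_one hns.ne', Real.mul_rpow hns.le hGs.le] at h
      have h2 : Real.Gamma (n + s) ^ s * Real.Gamma (n + s) ^ (1 - s) = Real.Gamma (n + s) := by
        rw [← Real.rpow_add hGs]; simp
      have h3 : (n + s) ^ (1 - s) * (n + s) ^ s = n + s := by
        rw [← Real.rpow_add hns]; simp
      have h4 : n * Real.Gamma n ≤ Real.Gamma (n + s) * (n + s) ^ (1 - s) := by
        calc _ ≤ _ := h
          _ = Real.Gamma (n + s) ^ s * Real.Gamma (n + s) ^ (1 - s) * (n + s) ^ (1 - s) := by ring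
          _ = _ := by rw [h2]
      calc n * Real.Gamma n * (n : ℝ) ^ s
          ≤ Real.Gamma (n + s) * (n + s) ^ (1 - s) * (n + s) ^ s := by
            gcongr; linarith
        _ = _ := by rw [mul_assoc, h3]
  set Q := Real.Gamma n * (n : ℝ) ^ s with hQ
  have hQ0 : 0 < Q := by positivity
  have hle : Real.Gamma (n + s) / Q ≤ 1 := (div_le_one hQ0).2 hup
  rw [abs_of_nonpos (by linarith), neg_sub, ← div_eq_mul_inv, sub_le_iff_le_add]
  have h5 : n * Q ≤ Real.Gamma (n + s) * n + Q * s := by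
    have : Real.Gamma (n + s) * s ≤ Q * s := by gcongr
    nlinarith
  have e3 : s / n + Real.Gamma (n + s) / Q = (Real.Gamma (n + s) * n + Q * s) / (n * Q) := by
    field_simp; ring
  rw [e3, le_div_iff₀ (by positivity), one_mul]
  exact h5

lemma Gamma_ratio_add_one_eq {s : ℝ} {n : ℕ} (hn : 1 ≤ n) (hns : 0 < n + s) :
    Real.Gamma (n + (s + 1)) / n.factorial / (n : ℝ) ^ (s + 1 - 1) =
      (1 + s / n) * (Real.Gamma (n + s) / n.factorial / (n : ℝ) ^ (s - 1)) := by
  have hn0 : (0 : ℝ) < n := by exact_mod_cast hn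
  rw [← add_assoc, Real.Gamma_add_one hns.ne', show s + 1 - 1 = (s - 1) + 1 by ring,
    Real.rpow_add hn0, Real.rpow_one]
  field_simp

/-- `Γ(n + s) / n! = n ^ (s - 1) (1 + O(1 / n))`. -/
theorem isOneAddBigOInv_Gamma (s : ℝ) :
    IsOneAddBigOInv atTop (fun n : ℕ => (n : ℝ))
      fun n : ℕ => Real.Gamma (n + s) / n.factorial / (n : ℝ) ^ (s - 1) := by
  have hN : Tendsto (fun n : ℕ => (n : ℝ)) atTop atTop := tendsto_natCast_atTop_atTop
  have hev : ∀ s : ℝ, ∀ᶠ n : ℕ in atTop, 1 ≤ n ∧ 0 < n + s ∧ 1 + s / n ≠ 0 := fun s => by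
    filter_upwards [eventually_ge_atTop 1, hN.eventually_gt_atTop (-s)] with n h1 h2
    have hn0 : (0 : ℝ) < n := by exact_mod_cast h1
    refine ⟨h1, by linarith, ?_⟩
    have : 1 + s / n = (n + s) / n := by field_simp
    rw [this]
    exact (div_pos (by linarith) hn0).ne'
  -- Starting from the fractional part, the functional equation shifts the parameter by one in
  -- either direction at the cost of a factor `1 + s / n` or its inverse.
  have key : ∀ (m : ℤ) (s : ℝ), 0 ≤ s → s < 1 →
      IsOneAddBigOInv atTop (fun n : ℕ => (n : ℝ))
        fun n : ℕ => Real.Gamma (n + (s + m)) / n.factorial / (n : ℝ) ^ (s + m - 1) := by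
    intro m s h0 h1
    induction m using Int.induction_on with
    | zero => simpa using isOneAddBigOInv_Gamma_of_mem_Ico h0 h1
    | succ m ih =>
      refine ((IsOneAddBigOInv.one_add_div (s + m)).mul hN ih).congr' ?_
      filter_upwards [hev (s + m)] with n hn
      push_cast
      rw [← add_assoc s, Gamma_ratio_add_one_eq hn.1 hn.2.1]
    | pred m ih =>
      refine (((IsOneAddBigOInv.one_add_div (s + (-m - 1 : ℤ))).inv hN).mul hN ih).congr' ?_
      filter_upwards [hev (s + (-m - 1 : ℤ))] with n hn
      have e : s + ((-(m : ℤ) : ℤ) : ℝ) = s + (-m - 1 : ℤ) + 1 := by push_cast; ring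
      rw [e, Gamma_ratio_add_one_eq hn.1 hn.2.1, inv_mul_cancel_left₀ hn.2.2]
  have h := key ⌊s⌋ (Int.fract s) (Int.fract_nonneg s) (Int.fract_lt_one s)
  simpa only [Int.fract_add_floor] using h

end Ratios

section Asymptotics

open Asymptotics Filter Topology

/-! ### The saddle point -/

section SaddlePoint

variable {ε b r : ℝ}

lemma saddlePoint_equation (hε0 : 0 < ε) (hb : b ^ 2 = 2 * ε ^ 2 - 1) (hr : r = (ε - b) / (1 + ε))
    (hr0 : 0 < r) (hr1 : r < 1) :
    (1 + ε) * (r / (1 + r)) - (1 - ε) * (r / (1 - r)) = 1 - ε := by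
  have h1 : 1 + r ≠ 0 := by linarith
  have h2 : 1 - r ≠ 0 := by linarith
  have hq : (1 + ε) * r ^ 2 - 2 * ε * r + (1 - ε) = 0 := by
    rw [hr]
    have : 1 + ε ≠ 0 := by linarith
    field_simp
    linear_combination hb
  field_simp
  linear_combination -hq

/-- Shows that the curvature has the sign of `b`, and supplies the `b` under the root in the final
constant. -/
lemma saddlePoint_curvature (hε0 : 0 < ε) (hb : b ^ 2 = 2 * ε ^ 2 - 1)
    (hr : r = (ε - b) / (1 + ε)) (hr0 : 0 < r) (hr1 : r < 1) :
    r * ((1 + ε) / (1 + r) ^ 2 - (1 - ε) / (1 - r) ^ 2) * (1 - ε) * (1 + r) ^ 2 =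
      2 * r ^ 2 * (1 + ε) * b := by
  have h1 : 1 + r ≠ 0 := by linarith
  have h2 : 1 - r ≠ 0 := by linarith
  have hε : 1 + ε ≠ 0 := by linarith
  have key : (1 - ε) * ((1 + ε) * (1 - r) ^ 2 - (1 - ε) * (1 + r) ^ 2) =
      2 * r * (1 + ε) * b * (1 - r) ^ 2 := by
    rw [hr]
    field_simp
    linear_combination -(-2 * b ^ 2 + (2 * ε - 4) * b - 2 * ε ^ 2 + 2 * ε) * hb
  field_simp
  linear_combination key

end SaddlePoint

/-! ### Assembling the asymptotic formula -/

section Main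

variable {lam ε : ℝ}

/-- The main term, written in terms of the degrees. -/
noncomputable def ultraCoeffMain (lam ε : ℝ) (i j : ℕ) : ℝ :=
  cConst ε lam / ((2 : ℝ) ^ (i + 2 * lam) * (i : ℝ) ^ (1 / 2 : ℝ)) *
    ((1 + bHat ε) / (ε - bHat ε)) ^ ((i : ℝ) - j) *
    ((1 + 2 * ε - bHat ε) / (1 + ε)) ^ (i + j + 2 * lam)

lemma bHat_pos (h : 1 < 2 * ε ^ 2) : 0 < bHat ε := Real.sqrt_pos.2 (by linarith)

lemma sq_bHat (h : 1 < 2 * ε ^ 2) : bHat ε ^ 2 = 2 * ε ^ 2 - 1 := Real.sq_sqrt (by linarith)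

lemma bHat_lt (hε0 : 0 < ε) (hε1 : ε < 1) : bHat ε < ε := by
  rw [bHat, Real.sqrt_lt' hε0]
  nlinarith

lemma ultraCoeffMain_pos (hε0 : 0 < ε) (hε1 : ε < 1) (h : 1 < 2 * ε ^ 2) {i : ℕ} (j : ℕ)
    (hi : 1 ≤ i) : 0 < ultraCoeffMain lam ε i j := by
  have hb := bHat_pos h
  have hbε := bHat_lt hε0 hε1
  have h1 : 0 < ε - bHat ε := by linarith
  have h2 : 0 < 1 + 2 * ε - bHat ε := by linarith
  have h3 : 0 < 1 - ε ^ 2 := by nlinarith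
  have h4 : 0 < 2 * ε ^ 2 - 1 := by linarith
  have hi0 : (0 : ℝ) < i := by exact_mod_cast hi
  rw [ultraCoeffMain, cConst]
  have := Real.pi_pos
  have : 0 < Real.sqrt (Real.pi * (1 - ε ^ 2) * (2 * ε ^ 2 - 1) ^ (1 / 2 : ℝ)) :=
    Real.sqrt_pos.2 (by positivity)
  positivity

lemma ultraCoeff_div_main_eq (hlam : -1 / 2 < lam) (hε0 : 0 < ε) (hε1 : ε < 1)
    (h : 1 < 2 * ε ^ 2) {r a : ℝ} (hr : r = (ε - bHat ε) / (1 + ε)) (hr0 : 0 < r) (hr1 : r < 1)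
    (ha0 : 0 < a) (ha : a * (1 - ε) * (1 + r) ^ 2 = 2 * r ^ 2 * (1 + ε) * bHat ε) {i j p : ℕ}
    (hi : i = j + p + 1) (hj1 : 1 ≤ j) (hj : (j : ℝ) = ε * i) :
    ultraCoeff lam i j / ultraCoeffMain lam ε i j =
      (binomialProductCoeff (i + j + 2 * lam - 1) p /
        ((1 + r) ^ (i + j + 2 * lam - 1) * (1 - r) ^ (p + 1) * (r⁻¹) ^ p *
          (Real.sqrt (2 * Real.pi / (a * i)) / (2 * Real.pi)))) *
      Real.sqrt ((1 + lam / i) * (1 + lam / j) *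
        (Real.Gamma (j + 2 * lam) / j.factorial / (j : ℝ) ^ (2 * lam - 1)) *
        (Real.Gamma (i + 2 * lam) / i.factorial / (i : ℝ) ^ (2 * lam - 1))⁻¹) := by
  have hb := bHat_pos h
  have hi0 : (0 : ℝ) < i := by exact_mod_cast (by omega : 0 < i)
  have hj0 : (0 : ℝ) < j := by exact_mod_cast hj1
  have hj1' : (1 : ℝ) ≤ j := by exact_mod_cast hj1
  have hi1' : (1 : ℝ) ≤ i := by exact_mod_cast (by omega : 1 ≤ i)
  have hπ := Real.pi_pos
  have hr2 : 0 < 1 + r := by linarith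
  have hr3 : 0 < 1 - r := by linarith
  have hε2 : 0 < 1 - ε := by linarith
  have hε3 : 0 < 1 + ε := by linarith
  have hM := ultraCoeffMain_pos (lam := lam) hε0 hε1 h j (by omega : 1 ≤ i)
  -- the square root in the exact formula
  have gi := Real.Gamma_pos_of_pos (show 0 < i + 2 * lam by linarith)
  have gj := Real.Gamma_pos_of_pos (show 0 < j + 2 * lam by linarith)
  have fi : (0 : ℝ) < i.factorial := by exact_mod_cast i.factorial_pos
  have fj : (0 : ℝ) < j.factorial := by exact_mod_cast j.factorial_pos
  -- The source of the factor `ε ^ lam` in the constant.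
  have hpow : (j : ℝ) ^ (2 * lam - 1) * (i * j) = (i : ℝ) ^ (2 * lam - 1) * (i * ε ^ lam) ^ 2 := by
    have e1 : (ε ^ lam) ^ 2 = ε ^ (2 * lam - 1) * ε := by
      rw [← Real.rpow_natCast, ← Real.rpow_mul hε0.le, ← Real.rpow_add_one hε0.ne']
      congr 1
      push_cast; ring
    rw [mul_pow, e1, hj, Real.mul_rpow hε0.le hi0.le]
    ring
  set W := (1 + lam / i) * (1 + lam / j) *
        (Real.Gamma (j + 2 * lam) / j.factorial / (j : ℝ) ^ (2 * lam - 1)) *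
        (Real.Gamma (i + 2 * lam) / i.factorial / (i : ℝ) ^ (2 * lam - 1))⁻¹ with hW
  have hsq : Real.sqrt ((i + lam) * (j + lam) * (Real.Gamma (j + 2 * lam) / j.factorial) /
        (Real.Gamma (i + 2 * lam) / i.factorial)) = i * ε ^ lam * Real.sqrt W := by
    rw [← Real.sqrt_sq (show 0 ≤ i * ε ^ lam by positivity), ← Real.sqrt_mul (by positivity)]
    congr 1
    have hpi : (0 : ℝ) < (i : ℝ) ^ (2 * lam - 1) := by positivity
    have hpj : (0 : ℝ) < (j : ℝ) ^ (2 * lam - 1) := by positivity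
    have hsq2 : (i * ε ^ lam) ^ 2 = (j : ℝ) ^ (2 * lam - 1) * (i * j) / (i : ℝ) ^ (2 * lam - 1) := by
      rw [eq_div_iff hpi.ne', hpow]; ring
    rw [hsq2, hW]
    generalize (i : ℝ) ^ (2 * lam - 1) = x at *
    generalize (j : ℝ) ^ (2 * lam - 1) = y at *
    generalize Real.Gamma (i + 2 * lam) = x' at *
    generalize Real.Gamma (j + 2 * lam) = y' at *
    field_simp
  -- the constants
  set S := Real.sqrt (2 * Real.pi / (a * i)) with hS
  have hS0 : 0 < S := Real.sqrt_pos.2 (by positivity)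
  -- `S / (2 π)` is the Gaussian value, `2 / (1 - ε)` comes from the exact formula with `p + 1 = (1
  -- - ε) i`, and `r / (1 + r)` corrects the exponents `p` and `i + j + 2 lam - 1`, each one short.
  -- The curvature identity eliminates `r`.
  have hconst : S / (2 * Real.pi) * (2 * r / ((1 - ε) * (1 + r))) =
      1 / Real.sqrt (Real.pi * (1 - ε ^ 2) * (2 * ε ^ 2 - 1) ^ (1 / 2 : ℝ)) /
        (i : ℝ) ^ (1 / 2 : ℝ) := by
    have e0 : (2 * ε ^ 2 - 1) ^ (1 / 2 : ℝ) = bHat ε := by rw [bHat, Real.sqrt_eq_rpow]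
    have h3 : 0 < 1 - ε ^ 2 := by nlinarith
    rw [e0, ← Real.sqrt_eq_rpow, div_div, ← Real.sqrt_mul (by positivity), one_div,
      ← Real.sqrt_inv, eq_comm, Real.sqrt_eq_iff_mul_self_eq (by positivity) (by positivity)]
    have hS2 : S * S = 2 * Real.pi / (a * i) := Real.mul_self_sqrt (by positivity)
    have e1 : S / (2 * Real.pi) * (2 * r / ((1 - ε) * (1 + r))) *
        (S / (2 * Real.pi) * (2 * r / ((1 - ε) * (1 + r)))) =
        (S * S) * (r / (Real.pi * ((1 - ε) * (1 + r)))) ^ 2 := by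
      field_simp
    rw [e1, hS2]
    have e2 : a = 2 * r ^ 2 * (1 + ε) * bHat ε / ((1 - ε) * (1 + r) ^ 2) := by
      rw [eq_div_iff (by positivity), ← ha]; ring
    have e3 : 1 - ε ^ 2 = (1 - ε) * (1 + ε) := by ring
    rw [e2, e3]
    field_simp
  have hbase1 : (1 + bHat ε) / (ε - bHat ε) = (1 - r) / r := by
    have : ε - bHat ε ≠ 0 := by
      intro h0; rw [hr, h0, zero_div] at hr0; exact lt_irrefl _ hr0
    rw [hr]; field_simp; ring
  have hbase2 : (1 + 2 * ε - bHat ε) / (1 + ε) = 1 + r := by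
    rw [hr]; field_simp; ring
  have hp1 : (p : ℝ) + 1 = (1 - ε) * i := by
    rw [sub_mul, ← hj, hi]; push_cast; ring
  have hpw1 : ((1 - r) / r) ^ ((i : ℝ) - j) = (1 - r) ^ (p + 1) * (r⁻¹) ^ p / r := by
    rw [show (i : ℝ) - j = ((p + 1 : ℕ) : ℝ) by rw [hi]; push_cast; ring, Real.rpow_natCast,
      div_pow, pow_succ r p, inv_pow]
    field_simp
  have hpw2 : (1 + r) ^ (i + j + 2 * lam) = (1 + r) ^ (i + j + 2 * lam - 1) * (1 + r) := by
    rw [← Real.rpow_add_one hr2.ne']; congr 1; ring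
  have hpw3 : (2 : ℝ) ^ (i + 2 * lam) = (((1 : ℝ) / 2) ^ i * 2 ^ (-(2 * lam)))⁻¹ := by
    rw [Real.rpow_add (by norm_num), Real.rpow_natCast, Real.rpow_neg (by norm_num), mul_inv,
      inv_inv, one_div, inv_pow, inv_inv]
  have hmain : ultraCoeffMain lam ε i j = ε ^ lam * (S / (2 * Real.pi) *
      (2 * r / ((1 - ε) * (1 + r)))) * (((1 : ℝ) / 2) ^ i * 2 ^ (-(2 * lam))) *
      ((1 - r) ^ (p + 1) * (r⁻¹) ^ p / r) * ((1 + r) ^ (i + j + 2 * lam - 1) * (1 + r)) := by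
    rw [ultraCoeffMain, cConst, hbase1, hbase2, hpw1, hpw2, hpw3, hconst]
    field_simp
  rw [div_eq_iff hM.ne', ultraCoeff_eq hlam hj1 hi, hsq, hmain, hp1]
  have : 0 < ε ^ lam := by positivity
  have : (0 : ℝ) < 2 ^ (-(2 * lam)) := by positivity
  have : 0 < (1 + r) ^ (i + j + 2 * lam - 1) := by positivity
  generalize (1 + r) ^ (i + j + 2 * lam - 1) = A at *
  generalize (2 : ℝ) ^ (-(2 * lam)) = T at *
  generalize ε ^ lam = E at *
  generalize binomialProductCoeff (i + j + 2 * lam - 1) p = B at *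
  generalize Real.sqrt W = W' at *
  field_simp

/-- The relative error of the main term is `O(1 / i)` along `j = ε i → ∞`. -/
theorem isOneAddBigOInv_ultraCoeff_div_main (hlam : -1 / 2 < lam) (hε0 : 0 < ε) (hε1 : ε < 1)
    (h : 1 < 2 * ε ^ 2) :
    IsOneAddBigOInv (comap Prod.fst atTop ⊓ 𝓟 {x : ℕ × ℕ | (x.2 : ℝ) = ε * x.1})
      (fun x => (x.1 : ℝ)) fun x => ultraCoeff lam x.1 x.2 / ultraCoeffMain lam ε x.1 x.2 := by
  set l := comap Prod.fst atTop ⊓ 𝓟 {x : ℕ × ℕ | (x.2 : ℝ) = ε * x.1} with hl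
  have hb := bHat_pos h
  have hbε := bHat_lt hε0 hε1
  obtain ⟨r, hr⟩ : ∃ r, r = (ε - bHat ε) / (1 + ε) := ⟨_, rfl⟩
  have hr0 : 0 < r := by rw [hr]; exact div_pos (by linarith) (by linarith)
  have hr1 : r < 1 := by rw [hr, div_lt_one (by linarith)]; linarith
  obtain ⟨a, ha⟩ : ∃ a, a = r * ((1 + ε) / (1 + r) ^ 2 - (1 - ε) / (1 - r) ^ 2) := ⟨_, rfl⟩
  have hcurv := saddlePoint_curvature hε0 (sq_bHat h) hr hr0 hr1
  rw [← ha] at hcurv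
  have ha0 : 0 < a := by
    have h1 : 0 < (1 - ε) * (1 + r) ^ 2 := mul_pos (by linarith) (by positivity)
    have h2 : 0 < a * ((1 - ε) * (1 + r) ^ 2) := by rw [← mul_assoc, hcurv]; positivity
    exact pos_of_mul_pos_left h2 h1.le
  obtain ⟨K, hK, hB⟩ := exists_abs_binomialProductCoeff_sub_le lam hε0 hε1 hr0 hr1
    (saddlePoint_equation hε0 (sq_bHat h) hr hr0 hr1) ha ha0
  have hfst : Tendsto (fun x : ℕ × ℕ => x.1) l atTop := tendsto_comap.mono_left inf_le_left
  have hN : Tendsto (fun x : ℕ × ℕ => (x.1 : ℝ)) l atTop :=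
    tendsto_natCast_atTop_atTop.comp hfst
  have hmem : ∀ᶠ x in l, (x.2 : ℝ) = ε * x.1 := mem_inf_of_right (mem_principal_self _)
  have hsnd : Tendsto (fun x : ℕ × ℕ => x.2) l atTop := by
    rw [← tendsto_natCast_atTop_iff (R := ℝ)]
    refine (hN.const_mul_atTop hε0).congr' ?_
    filter_upwards [hmem] with x hx using hx.symm
  have hdeg : ∀ᶠ x in l, 1 ≤ x.2 ∧ ∃ p, x.1 = x.2 + p + 1 := by
    filter_upwards [hmem, hsnd.eventually_ge_atTop 1, hfst.eventually_ge_atTop 1] with x hx h1 h2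
    refine ⟨h1, ?_⟩
    have hx0 : (0 : ℝ) < x.1 := by exact_mod_cast h2
    have : (x.2 : ℝ) < x.1 := by rw [hx]; nlinarith
    have : x.2 < x.1 := by exact_mod_cast this
    exact ⟨x.1 - x.2 - 1, by omega⟩
  have hinv : (fun x : ℕ × ℕ => ((x.2 : ℝ))⁻¹) =O[l] fun x => ((x.1 : ℝ))⁻¹ := by
    refine IsBigO.of_bound ε⁻¹ ?_
    filter_upwards [hmem] with x hx
    rw [hx, mul_inv, norm_mul, Real.norm_of_nonneg (inv_nonneg.2 hε0.le)]
  have hGi : IsOneAddBigOInv l (fun x : ℕ × ℕ => (x.1 : ℝ)) fun x =>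
      Real.Gamma (x.1 + 2 * lam) / x.1.factorial / (x.1 : ℝ) ^ (2 * lam - 1) :=
    (isOneAddBigOInv_Gamma (2 * lam)).comp_tendsto hfst
  have hGj : IsOneAddBigOInv l (fun x : ℕ × ℕ => (x.1 : ℝ)) fun x =>
      Real.Gamma (x.2 + 2 * lam) / x.2.factorial / (x.2 : ℝ) ^ (2 * lam - 1) :=
    IsBigO.trans ((isOneAddBigOInv_Gamma (2 * lam)).comp_tendsto hsnd) hinv
  have h1 : IsOneAddBigOInv l (fun x : ℕ × ℕ => (x.1 : ℝ)) fun x => 1 + lam / (x.1 : ℝ) :=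
    IsOneAddBigOInv.one_add_div lam
  have h2 : IsOneAddBigOInv l (fun x : ℕ × ℕ => (x.1 : ℝ)) fun x => 1 + lam / (x.2 : ℝ) :=
    IsBigO.trans (IsOneAddBigOInv.one_add_div (N := fun x : ℕ × ℕ => (x.2 : ℝ)) lam) hinv
  have hsqrt := (((h1.mul hN h2).mul hN hGj).mul hN (hGi.inv hN)).sqrt
  -- The truncated difference is the true `p` wherever `j < i`, which holds eventually.
  have hBO : IsOneAddBigOInv l (fun x : ℕ × ℕ => (x.1 : ℝ)) fun x =>
      binomialProductCoeff (x.1 + x.2 + 2 * lam - 1) (x.1 - x.2 - 1) /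
        ((1 + r) ^ (x.1 + x.2 + 2 * lam - 1) * (1 - r) ^ (x.1 - x.2 - 1 + 1) *
          (r⁻¹) ^ (x.1 - x.2 - 1) *
          (Real.sqrt (2 * Real.pi / (a * x.1)) / (2 * Real.pi))) := by
    refine IsBigO.of_bound K ?_
    filter_upwards [hmem, hdeg] with x hx hd
    obtain ⟨hd1, p, hp⟩ := hd
    have := hB x.1 x.2 (x.1 - x.2 - 1) (by omega) hx
    rwa [div_eq_mul_inv K, ← Real.norm_eq_abs, ← Real.norm_of_nonneg
      (inv_nonneg.2 (Nat.cast_nonneg x.1))] at this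
  refine (hBO.mul hN hsqrt).congr' ?_
  filter_upwards [hmem, hdeg] with x hx hd
  obtain ⟨hd1, p, hp⟩ := hd
  exact (ultraCoeff_div_main_eq hlam hε0 hε1 h hr hr0 hr1 ha0 hcurv (by omega) hd1 hx).symm

end Main

theorem mainTheorem5 (lam k₁ k₂ : ℝ) (hlam : -1 / 2 < lam) (hk₂ : 0 < k₂) (hk : k₂ < k₁)
    (hε : 1 < Real.sqrt 2 * k₂ / k₁) :
    ∃ K t₀ : ℝ, 0 < t₀ ∧ ∀ t : ℝ, t₀ ≤ t → ∀ i j : ℕ, (i : ℝ) = k₁ * t → (j : ℝ) = k₂ * t →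
      ∃ δ : ℝ, |δ| ≤ K / t ∧
        ultraCoeff lam i j =
          cConst (k₂ / k₁) lam / ((2 : ℝ) ^ (k₁ * t + 2 * lam) * (k₁ * t) ^ (1 / 2 : ℝ)) *
            ((1 + bHat (k₂ / k₁)) / (k₂ / k₁ - bHat (k₂ / k₁))) ^ ((k₁ - k₂) * t) *
            ((1 + 2 * (k₂ / k₁) - bHat (k₂ / k₁)) / (1 + k₂ / k₁)) ^
              ((k₁ + k₂) * t + 2 * lam) *
            (1 + δ) := by
  have hk₁ : 0 < k₁ := hk₂.trans hk
  have hε0 : 0 < k₂ / k₁ := div_pos hk₂ hk₁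
  have hε1 : k₂ / k₁ < 1 := (div_lt_one hk₁).2 hk
  have hε2 : 1 < 2 * (k₂ / k₁) ^ 2 := by
    rw [mul_div_assoc] at hε
    have h := one_lt_pow₀ hε (two_ne_zero)
    rwa [mul_pow, Real.sq_sqrt (by norm_num)] at h
  obtain ⟨K, hK⟩ := IsBigO.bound (isOneAddBigOInv_ultraCoeff_div_main hlam hε0 hε1 hε2)
  rw [eventually_inf_principal, eventually_comap] at hK
  obtain ⟨n₀, hn₀⟩ := eventually_atTop.1 hK
  -- Since `i = k₁ t`, the bound `K / i` is `(K / k₁) / t`. The `+ 1` makes `t₀` positive and forces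
  -- `1 ≤ i`, so the main term can be divided out.
  refine ⟨K / k₁, (n₀ + 1) / k₁, by positivity, fun t ht i j hi hj => ?_⟩
  have hit : (n₀ : ℝ) + 1 ≤ i := by
    rw [hi, mul_comm]; exact (div_le_iff₀ hk₁).1 ht
  have ht0 : 0 < t := lt_of_lt_of_le (by positivity) ht
  have hi1 : n₀ + 1 ≤ i := by exact_mod_cast hit
  have hmain := ultraCoeffMain_pos (lam := lam) hε0 hε1 hε2 j (by omega : 1 ≤ i)
  have hji : (j : ℝ) = k₂ / k₁ * i := by rw [hi, hj]; field_simp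
  have hb := hn₀ i (by omega) (i, j) rfl hji
  refine ⟨ultraCoeff lam i j / ultraCoeffMain lam (k₂ / k₁) i j - 1, ?_, ?_⟩
  · rw [Real.norm_eq_abs, Real.norm_of_nonneg (by positivity)] at hb
    refine hb.trans (le_of_eq ?_)
    simp only
    rw [hi]
    field_simp
  · have e : cConst (k₂ / k₁) lam / ((2 : ℝ) ^ (k₁ * t + 2 * lam) * (k₁ * t) ^ (1 / 2 : ℝ)) *
            ((1 + bHat (k₂ / k₁)) / (k₂ / k₁ - bHat (k₂ / k₁))) ^ ((k₁ - k₂) * t) *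
            ((1 + 2 * (k₂ / k₁) - bHat (k₂ / k₁)) / (1 + k₂ / k₁)) ^
              ((k₁ + k₂) * t + 2 * lam) = ultraCoeffMain lam (k₂ / k₁) i j := by
      rw [ultraCoeffMain, hi, hj]
      ring_nf
    rw [e, add_sub_cancel, mul_div_cancel₀ _ hmain.ne']

end Asymptotics
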